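/- Let $P_{\theta,\rho}=\frac{1+\rho}{2}N(\theta,I_d)+\frac{1-\rho}{2}N(-\theta,I_d)$ on $\mathbb R^d$ and $\beta_\rho=\frac12\log\frac{1+\rho}{1-\rho}$. For a ground truth $(\theta_*,\rho_*)$, write $f(\theta)=\mathbb E[X\tanh(\langle\theta,X\rangle+\beta_{\rho_*})]$ with $X\sim P_{\theta_*,\rho_*}$. For samples $x_1,\dots,x_n\in\mathbb R^d$, write $\mathbb E_n[X]=\frac1n\sum_i x_i$ and $f_n(\theta)=\frac1n\sum_{i}x_i\tanh(\langle\theta,x_i\rangle+\beta_{\rho_*})$. For $C_\omega>0$ let $\omega=\sqrt{C_\omega\, d\log n/n}$. Theorem. Let $C_\theta>0$ and $C_\rho\in(0,1)$. There exist $n_0\in\mathbb N$ and positive constants $C_1,\dots,C_6,D_3,D_4$, depending only on $(C_\theta,C_\rho)$, such that the following holds for all $C_\omega>0$, all $d\ge1$, all $n\ge n_0$, all $\theta_*\in\mathbb R^d$ with $\|\theta_*\|\le C_\theta$, and all $\rho_*$ with $|\rho_*|\le C_\rho$ and $\rho_*>C_1\sqrt{\omega}$. Put $\eta=\|\theta_*\|$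 and $\rho=\rho_*$. Suppose that the samples lie in the concentration event $$\|f_n(\theta)-f(\theta)\|\le\max\{\|\theta\|,\rho\}\,\omega\qquad\text{for all }\theta\in\mathbb R^d\text{ with }\|\theta\|\le5(\sqrt d+C_\theta).$$ Then the empirical EM iteration $\theta_{t+1}=f_n(\theta_t)$, started at $\theta_0=0$ or at $\theta_0=\frac1{\rho}\mathbb E_n[X]$, satisfies $$\|\theta_t-\theta_*\|\le C_2\,\frac{\omega}{\max\{\rho,\eta\}}=C_2\min\Big\{\frac{\omega}{\rho},\frac{\omega}{\eta}\Big\}\qquad\text{for all integers } t\ge T^{(1)}_{\theta_0}+T^{(d)}_G$$ (with $\omega/\eta=+\infty$ if $\eta=0$), where $$T^{(1)}_{\theta_0=0}=\begin{cases}1,&\eta\le\frac{\omega}{\rho},\\ \frac{C_3}{\rho^2}\log\left(\frac{C_5\rho}{\omega}\right),&\frac{\omega}{\rho}<\eta\le C_4\rho,\\ C_3\left(\frac1{\rho\eta}+\frac1{\eta^2}\log\frac{1}{C_6\rho\omega}\right),&\text{otherwise,}\end{cases}$$ $$T^{(1)}_{\theta_0=\frac1\rho\mathbb E_n[X]}=\begin{cases}1,&\eta\le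 C_4\rho,\\ \frac{C_3}{\eta^2}\log\frac{1}{C_6\rho\omega},&\eta>C_4\rho,\end{cases}\qquad T^{(d)}_G=\begin{cases}1,&\eta\le\rho,\\ \frac{D_3}{\eta^2}\log\left(\frac{\eta}{D_4\,\omega}\right),&\eta>\rho.\end{cases}$$ -/

import Mathlib

open MeasureTheory ProbabilityTheory

noncomputable section

namespace EMMixture

/-- The law `P_{θ,ρ} = (1+ρ)/2 · N(θ, I_d) + (1-ρ)/2 · N(-θ, I_d)` of the symmetric two-component
Gaussian mixture on `ℝ^d`. -/
def mixture {d : ℕ} (θ : EuclideanSpace ℝ (Fin d)) (ρ : ℝ) :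
    Measure (EuclideanSpace ℝ (Fin d)) :=
  ENNReal.ofReal ((1 + ρ) / 2) •
      (stdGaussian (EuclideanSpace ℝ (Fin d))).map (fun z => θ + z) +
    ENNReal.ofReal ((1 - ρ) / 2) •
      (stdGaussian (EuclideanSpace ℝ (Fin d))).map (fun z => -θ + z)

/-- The inverse temperature `β_ρ = (1/2) log ((1+ρ)/(1-ρ))`. -/
def beta (ρ : ℝ) : ℝ := 1 / 2 * Real.log ((1 + ρ) / (1 - ρ))

/-- The EM summand `x · tanh(⟨θ, x⟩ + β_ρ)`. -/
def emTerm {d : ℕ} (θ : EuclideanSpace ℝ (Fin d)) (ρ : ℝ) (x : EuclideanSpace ℝ (Fin d)) :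
    EuclideanSpace ℝ (Fin d) :=
  Real.tanh (inner ℝ θ x + beta ρ) • x

/-- The population mean EM map `f(θ, ρ | θ*, ρ*) = 𝔼[X tanh(⟨θ, X⟩ + β_ρ)]`, `X ∼ P_{θ*,ρ*}`. -/
def popMean {d : ℕ} (θs : EuclideanSpace ℝ (Fin d)) (ρs : ℝ)
    (θ : EuclideanSpace ℝ (Fin d)) (ρ : ℝ) : EuclideanSpace ℝ (Fin d) :=
  ∫ x, emTerm θ ρ x ∂(mixture θs ρs)

/-- The empirical mean `𝔼_n[X]` of the sample `x_1, …, x_n`. -/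
def sampleAverage {d n : ℕ} (x : Fin n → EuclideanSpace ℝ (Fin d)) :
    EuclideanSpace ℝ (Fin d) :=
  (1 / (n : ℝ)) • ∑ i, x i

/-- The sample mean EM map `f_n(θ, ρ) = 𝔼_n[X tanh(⟨θ, X⟩ + β_ρ)]`. -/
def sampleMean {d n : ℕ} (x : Fin n → EuclideanSpace ℝ (Fin d))
    (θ : EuclideanSpace ℝ (Fin d)) (ρ : ℝ) : EuclideanSpace ℝ (Fin d) :=
  sampleAverage (fun i => emTerm θ ρ (x i))

/-- The empirical mean EM iteration `θ_{t+1} = f_n(θ_t, ρ)` started at `θ₀`. -/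
def emIter {d n : ℕ} (x : Fin n → EuclideanSpace ℝ (Fin d)) (ρ : ℝ)
    (θ₀ : EuclideanSpace ℝ (Fin d)) : ℕ → EuclideanSpace ℝ (Fin d)
  | 0 => θ₀
  | t + 1 => sampleMean x (emIter x ρ θ₀ t) ρ

/-- The statistical accuracy `ω = √(C_ω d log n / n)`. -/
def omega (Cω : ℝ) (d n : ℕ) : ℝ := Real.sqrt (Cω * (d * Real.log n / n))

/-- The concentration event, as a property of the realised sample:
`‖f_n(θ, ρ*) - f(θ, ρ*)‖ ≤ max{‖θ‖, ρ*} ω` for all `‖θ‖ ≤ 5 (√d + C_θ)`. -/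
def ConcentrationEvent (Cθ Cω : ℝ) {d n : ℕ} (θs : EuclideanSpace ℝ (Fin d)) (ρs : ℝ)
    (x : Fin n → EuclideanSpace ℝ (Fin d)) : Prop :=
  ∀ θ : EuclideanSpace ℝ (Fin d), ‖θ‖ ≤ 5 * (Real.sqrt d + Cθ) →
    ‖sampleMean x θ ρs - popMean θs ρs θ ρs‖ ≤ max ‖θ‖ ρs * omega Cω d n

/-- The signal convergence time for the initialisation `θ₀ = 0`. -/
def signalTimeZero (C₃ C₄ C₅ C₆ η ρ ω : ℝ) : ℝ :=
  if η ≤ ω / ρ then 1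
  else if η ≤ C₄ * ρ then C₃ * (1 / ρ ^ 2 * Real.log (C₅ * ρ / ω))
  else C₃ * (1 / (ρ * η) + 1 / η ^ 2 * Real.log (1 / (C₆ * ρ * ω)))

/-- The signal convergence time for the initialisation `θ₀ = (1/ρ) 𝔼_n[X]`. -/
def signalTimeMoment (C₃ C₄ C₆ η ρ ω : ℝ) : ℝ :=
  if η ≤ C₄ * ρ then 1
  else C₃ * (1 / η ^ 2 * Real.log (1 / (C₆ * ρ * ω)))

/-- The additional time `T_G` needed by the component orthogonal to the signal. -/
def orthogonalTime (D₃ D₄ η ρ ω : ℝ) : ℝ :=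
  if η ≤ ρ then 1 else D₃ / η ^ 2 * Real.log (η / (D₄ * ω))

end EMMixture

end

noncomputable section

namespace EMMixture

/-! ### The hyperbolic tangent -/

/-! Write `η = ‖θs‖`. Since `tanh` is odd, folding the component centred at `-θs` onto the other
turns the population map into an expectation of `response ρ ⟨θ, X⟩ • X` with `X` normal about `θs`.
Stein's identity then gives `f(θ) = A θs + B θ` (`popMean_eq`), with `A`, `B` Gaussian averages of
the response and of its derivative at mean `⟨θ, θs⟩` and variance `‖θ‖²`.

The part of `θ` orthogonal to `θs`, of size `b`, is multiplied by `B ≤ 1 - k (ρ² + ‖θ‖²)`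
(`selfCoef_le`). The part `α` along `θs` follows the scalar map `signalMap`, up to an error of order
`b²`: `A` and `B` are Lipschitz in the variance, and `‖θ‖² - α² = b²`. The scalar map is monotone
and fixes `η`. Below `η` it gains at least `k (ρ² + αη)(η - α)` (`ascent_le_signalMap_sub`); above,
it contracts by `1 - k η²` (`signalMap_sub_le`).

The condition on `C₁` says `ω ≤ ε ρ²` with `ε` small. If `η ≤ C₄ ρ`, the whole vector contracts
towards `θs` at rate of order `ρ²` against noise of order `ρω`, which leaves an error of order
`ω/ρ`. If `η > C₄ ρ`, the bound `b ≤ ω/(kρ)` is preserved, so `b² = O(ω)` and the total noise per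
step is `O(ηω)`, a small fraction of the drift (`Invariant.step`). The signal grows geometrically to
`η/2` from a seed of order `ηρ²`; from then on `|α - η| + b` contracts at rate of order `η²`, which
leaves an error of order `ω/η` (`large_signal_convergence`). The moment start is controlled by the
concentration event at `θ = 0`, because `f_n(0) = ρ 𝔼_n[X]`. -/

theorem hasDerivAt_tanh (x : ℝ) : HasDerivAt Real.tanh (1 - Real.tanh x ^ 2) x := by
  have h := (Real.hasDerivAt_sinh x).div (Real.hasDerivAt_cosh x) (Real.cosh_pos x).ne'
  have h2 : (Real.sinh / Real.cosh : ℝ → ℝ) = Real.tanh := by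
    funext y; simp [Real.tanh_eq_sinh_div_cosh]
  rw [h2] at h
  have hc := (Real.cosh_pos x).ne'
  have h3 : 1 - Real.tanh x ^ 2 =
      (Real.cosh x * Real.cosh x - Real.sinh x * Real.sinh x) / Real.cosh x ^ 2 := by
    rw [Real.tanh_eq_sinh_div_cosh]
    field_simp
  rw [h3]
  exact h

theorem continuous_tanh : Continuous Real.tanh :=
  continuous_iff_continuousAt.2 fun x => (hasDerivAt_tanh x).continuousAt

theorem tanh_mono : Monotone Real.tanh := by
  refine monotone_of_deriv_nonneg (fun x => (hasDerivAt_tanh x).differentiableAt) fun x => ?_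
  rw [(hasDerivAt_tanh x).deriv]
  linarith [Real.tanh_sq_lt_one x]

theorem one_sub_tanh_sq (x : ℝ) : 1 - Real.tanh x ^ 2 = 1 / Real.cosh x ^ 2 := by
  have := (Real.cosh_pos x).ne'
  rw [Real.tanh_eq_sinh_div_cosh]
  field_simp
  linarith [Real.cosh_sq x]

theorem tanh_nonneg {x : ℝ} (hx : 0 ≤ x) : 0 ≤ Real.tanh x := by
  simpa using tanh_mono hx

theorem div_cosh_le_tanh {x R : ℝ} (hx : 0 ≤ x) (hR : x ≤ R) :
    x / Real.cosh R ≤ Real.tanh x := by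
  rw [Real.tanh_eq_sinh_div_cosh]
  have h : Real.cosh x ≤ Real.cosh R := by
    rw [Real.cosh_le_cosh, abs_of_nonneg hx, abs_of_nonneg (hx.trans hR)]; exact hR
  exact div_le_div₀ (Real.sinh_nonneg_iff.2 hx) (Real.self_le_sinh_iff.2 hx) (Real.cosh_pos x) h

/-- Equivalent to `x ≤ sinh x cosh x`. It bounds the only term of possibly negative sign in
`symmetrised_bound_aux`. -/
theorem mul_one_sub_tanh_sq_le {x : ℝ} (hx : 0 ≤ x) :
    x * (1 - Real.tanh x ^ 2) ≤ Real.tanh x := by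
  have hc := Real.cosh_pos x
  rw [one_sub_tanh_sq, Real.tanh_eq_sinh_div_cosh, mul_one_div, div_le_div_iff₀ (by positivity) hc]
  have h1 := Real.self_le_sinh_iff.2 hx
  have h2 := Real.one_le_cosh x
  nlinarith [mul_nonneg (hx.trans h1) (sub_nonneg.2 h2), mul_le_mul_of_nonneg_right h1 hc.le,
    mul_nonneg (mul_nonneg (hx.trans h1) (sub_nonneg.2 h2)) hc.le]

theorem tanh_add (x y : ℝ) :
    Real.tanh (x + y) = (Real.tanh x + Real.tanh y) / (1 + Real.tanh x * Real.tanh y) := by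
  have h1 := (Real.cosh_pos x).ne'
  have h2 := (Real.cosh_pos y).ne'
  rw [Real.tanh_eq_sinh_div_cosh, Real.tanh_eq_sinh_div_cosh, Real.tanh_eq_sinh_div_cosh,
    Real.sinh_add, Real.cosh_add]
  have h3 : Real.sinh x / Real.cosh x + Real.sinh y / Real.cosh y =
      (Real.sinh x * Real.cosh y + Real.cosh x * Real.sinh y) / (Real.cosh x * Real.cosh y) := by
    field_simp
  have h4 : 1 + Real.sinh x / Real.cosh x * (Real.sinh y / Real.cosh y) =
      (Real.cosh x * Real.cosh y + Real.sinh x * Real.sinh y) / (Real.cosh x * Real.cosh y) := by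
    field_simp
  rw [h3, h4, div_div_div_cancel_right₀ (mul_ne_zero h1 h2)]

theorem tanh_beta {ρ : ℝ} (h : |ρ| < 1) : Real.tanh (beta ρ) = ρ := by
  have h' := abs_lt.1 h
  rw [beta, ← Real.artanh_eq_half_log ⟨h'.1.le, h'.2.le⟩]
  exact Real.tanh_artanh h'

theorem beta_nonneg {ρ : ℝ} (h0 : 0 ≤ ρ) (h : ρ < 1) : 0 ≤ beta ρ := by
  rw [beta, ← Real.artanh_eq_half_log ⟨by linarith, h.le⟩]
  exact Real.artanh_nonneg h0

/-! ### The symmetrised response -/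

/-- The average of `tanh (w ± β_ρ)` with weights `(1 ± ρ) / 2`. -/
def response (ρ w : ℝ) : ℝ :=
  (1 + ρ) / 2 * Real.tanh (w + beta ρ) + (1 - ρ) / 2 * Real.tanh (w - beta ρ)

/-- The derivative of `response ρ`. -/
def responseDeriv (ρ w : ℝ) : ℝ :=
  (1 + ρ) / 2 * (1 - Real.tanh (w + beta ρ) ^ 2) + (1 - ρ) / 2 * (1 - Real.tanh (w - beta ρ) ^ 2)

theorem hasDerivAt_response (ρ w : ℝ) : HasDerivAt (response ρ) (responseDeriv ρ w) w := by
  have h1 := ((hasDerivAt_tanh (w + beta ρ)).comp_add_const w (beta ρ)).const_mul ((1 + ρ) / 2)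
  have h2 := ((hasDerivAt_tanh (w - beta ρ)).comp_sub_const w (beta ρ)).const_mul ((1 - ρ) / 2)
  exact h1.add h2

theorem continuous_response (ρ : ℝ) : Continuous (response ρ) :=
  continuous_iff_continuousAt.2 fun x => (hasDerivAt_response ρ x).continuousAt

theorem continuous_responseDeriv (ρ : ℝ) : Continuous (responseDeriv ρ) := by
  unfold responseDeriv
  have := continuous_tanh
  fun_prop

theorem abs_response_le {ρ : ℝ} (h : |ρ| < 1) (w : ℝ) : |response ρ w| ≤ 1 := by
  have h' := abs_lt.1 h
  have h1 := abs_lt.1 (Real.abs_tanh_lt_one (w + beta ρ))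
  have h2 := abs_lt.1 (Real.abs_tanh_lt_one (w - beta ρ))
  rw [response, abs_le]
  constructor <;> nlinarith [h'.1, h'.2, h1.1, h1.2, h2.1, h2.2]

theorem responseDeriv_nonneg {ρ : ℝ} (h : |ρ| < 1) (w : ℝ) : 0 ≤ responseDeriv ρ w := by
  have h' := abs_lt.1 h
  have h1 := Real.tanh_sq_lt_one (w + beta ρ)
  have h2 := Real.tanh_sq_lt_one (w - beta ρ)
  unfold responseDeriv
  have := mul_nonneg (by linarith : 0 ≤ (1 + ρ) / 2) (sub_nonneg.2 h1.le)
  have := mul_nonneg (by linarith : 0 ≤ (1 - ρ) / 2) (sub_nonneg.2 h2.le)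
  linarith

theorem responseDeriv_eq_one_sub (ρ w : ℝ) : responseDeriv ρ w =
    1 - ((1 + ρ) / 2 * Real.tanh (w + beta ρ) ^ 2 + (1 - ρ) / 2 * Real.tanh (w - beta ρ) ^ 2) := by
  unfold responseDeriv; ring

theorem responseDeriv_le_one {ρ : ℝ} (h : |ρ| < 1) (w : ℝ) : responseDeriv ρ w ≤ 1 := by
  have h' := abs_lt.1 h
  rw [responseDeriv_eq_one_sub]
  have := mul_nonneg (by linarith : 0 ≤ (1 + ρ) / 2) (sq_nonneg (Real.tanh (w + beta ρ)))
  have := mul_nonneg (by linarith : 0 ≤ (1 - ρ) / 2) (sq_nonneg (Real.tanh (w - beta ρ)))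
  linarith

theorem abs_responseDeriv_le {ρ : ℝ} (h : |ρ| < 1) (w : ℝ) : |responseDeriv ρ w| ≤ 1 := by
  rw [abs_of_nonneg (responseDeriv_nonneg h w)]; exact responseDeriv_le_one h w

theorem response_mono {ρ : ℝ} (h : |ρ| < 1) : Monotone (response ρ) := by
  refine monotone_of_deriv_nonneg (fun x => (hasDerivAt_response ρ x).differentiableAt) fun x => ?_
  rw [(hasDerivAt_response ρ x).deriv]
  exact responseDeriv_nonneg h x

theorem one_add_mul_pos {ρ t : ℝ} (hρ : |ρ| < 1) (ht : |t| < 1) : 0 < 1 + t * ρ := by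
  have : |t * ρ| < 1 := by
    rw [abs_mul]; nlinarith [abs_nonneg t, abs_nonneg ρ]
  linarith [(abs_lt.1 this).1]

theorem tanh_add_beta {ρ : ℝ} (h : |ρ| < 1) (w : ℝ) :
    Real.tanh (w + beta ρ) = (Real.tanh w + ρ) / (1 + Real.tanh w * ρ) := by
  rw [tanh_add, tanh_beta h]

theorem tanh_sub_beta {ρ : ℝ} (h : |ρ| < 1) (w : ℝ) :
    Real.tanh (w - beta ρ) = (Real.tanh w - ρ) / (1 - Real.tanh w * ρ) := by
  rw [sub_eq_add_neg, tanh_add, Real.tanh_neg, tanh_beta h]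
  ring

/-- In terms of `t = tanh w` the denominator is even, so the odd part `(1 - ρ²) t` and the even part
`ρ² (1 - t²)` can be read off the numerator. This makes symmetrisation under `z ↦ -z` an algebraic
computation. -/
theorem response_eq {ρ : ℝ} (h : |ρ| < 1) (w : ℝ) :
    response ρ w = ((1 - ρ ^ 2) * Real.tanh w + ρ ^ 2 * (1 - Real.tanh w ^ 2)) /
      (1 - ρ ^ 2 * Real.tanh w ^ 2) := by
  have ht := Real.abs_tanh_lt_one w
  have h1 := one_add_mul_pos h ht
  have h2 := one_add_mul_pos (by rwa [abs_neg] : |-ρ| < 1) ht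
  have h2' : 0 < 1 - Real.tanh w * ρ := by linarith
  have h3 : 1 - ρ ^ 2 * Real.tanh w ^ 2 = (1 + Real.tanh w * ρ) * (1 - Real.tanh w * ρ) := by ring
  have h1' := h1.ne'
  have h2' := h2'.ne'
  rw [response, tanh_add_beta h, tanh_sub_beta h, h3]
  generalize Real.tanh w = t at h1' h2' ⊢
  rw [mul_comm t ρ] at h1' h2' ⊢
  field_simp
  ring

theorem responseDeriv_eq {ρ : ℝ} (h : |ρ| < 1) (w : ℝ) :
    responseDeriv ρ w = (1 - ρ ^ 2) * (1 - Real.tanh w ^ 2) *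
      (1 + ρ ^ 2 * Real.tanh w ^ 2 - 2 * ρ ^ 2 * Real.tanh w) /
      (1 - ρ ^ 2 * Real.tanh w ^ 2) ^ 2 := by
  have ht := Real.abs_tanh_lt_one w
  have h1 := one_add_mul_pos h ht
  have h2 := one_add_mul_pos (by rwa [abs_neg] : |-ρ| < 1) ht
  have h2' : 0 < 1 - Real.tanh w * ρ := by linarith
  have h3 : 1 - ρ ^ 2 * Real.tanh w ^ 2 = (1 + Real.tanh w * ρ) * (1 - Real.tanh w * ρ) := by ring
  have h1' := h1.ne'
  have h2' := h2'.ne'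
  rw [responseDeriv, tanh_add_beta h, tanh_sub_beta h, h3]
  generalize Real.tanh w = t at h1' h2' ⊢
  rw [mul_comm t ρ] at h1' h2' ⊢
  field_simp
  ring

/-- The algebraic core of the symmetrised monotonicity estimate. -/
theorem symmetrised_bound_aux {ρ t T w : ℝ} (hρ : ρ ^ 2 < 1) (ht0 : 0 ≤ t) (ht1 : t < 1)
    (htT : t ≤ T) (hw0 : 0 ≤ w) (hw : w * (1 - t ^ 2) ≤ t) :
    ρ ^ 2 * (1 - t ^ 2) * (1 - ρ ^ 2 * t ^ 2) ≤
      ((1 - ρ ^ 2) * t * T + ρ ^ 2 * (1 - t ^ 2)) * (1 - ρ ^ 2 * t ^ 2) +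
        w * (1 - t ^ 2) * (1 - ρ ^ 2) * ((1 + ρ ^ 2 * t ^ 2) * T - 2 * ρ ^ 2 * t) := by
  set p := ρ ^ 2 with hp
  have hp0 : 0 ≤ p := by positivity
  have ht2 : t ^ 2 < 1 := by nlinarith
  have hx : 0 < 1 - t ^ 2 := by linarith
  have hq : 0 < 1 - p * t ^ 2 := by nlinarith [mul_nonneg hp0 (sq_nonneg t)]
  have hr : 0 < 1 - p := by linarith
  have hT1 : (1 - p) * t * t * (1 - p * t ^ 2) ≤ (1 - p) * t * T * (1 - p * t ^ 2) := by
    gcongr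
  have hT2 : w * (1 - t ^ 2) * (1 - p) * ((1 + p * t ^ 2) * t - 2 * p * t) ≤
      w * (1 - t ^ 2) * (1 - p) * ((1 + p * t ^ 2) * T - 2 * p * t) := by
    have : 0 ≤ 1 + p * t ^ 2 := by positivity
    gcongr
  -- Uses `1 + p t² - 2 p = (1 - p)(2 - t²) - (1 - t²)`: the first piece contributes nonnegatively,
  -- and `hw` bounds the second.
  have hneg : -(t * (1 - p) * (t * (1 - t ^ 2))) ≤
      w * (1 - t ^ 2) * (1 - p) * ((1 + p * t ^ 2) * t - 2 * p * t) := by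
    have h1 : w * (1 - t ^ 2) * ((1 - p) * (t * (1 - t ^ 2))) ≤
        t * ((1 - p) * (t * (1 - t ^ 2))) := by gcongr
    have h2 : 0 ≤ w * (1 - t ^ 2) * (1 - p) * (t * ((1 - p) * (2 - t ^ 2))) := by
      have : 0 ≤ 2 - t ^ 2 := by linarith
      positivity
    nlinarith
  have hfin : 0 ≤ (1 - p) * t * t * ((1 - p) * t ^ 2) := by positivity
  nlinarith

/-- Pointwise lower bound for the even part of `y ↦ e^{s y} (d/dy) (y · response (α y))`,
with `w = α y` and `v = s y`. -/
theorem symmetrised_lower_bound {ρ w v : ℝ} (h : |ρ| < 1) (hw : 0 ≤ w) (hwv : w ≤ v) :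
    ρ ^ 2 * (1 - Real.tanh w ^ 2) * Real.cosh v ≤
      (Real.exp v * (response ρ w + w * responseDeriv ρ w) +
        Real.exp (-v) * (response ρ (-w) - w * responseDeriv ρ (-w))) / 2 ∧
    (2 * ρ ^ 2 ≤ 1 →
      (ρ ^ 2 * (1 - Real.tanh w ^ 2) + Real.tanh w * Real.tanh v / 2) * Real.cosh v ≤
      (Real.exp v * (response ρ w + w * responseDeriv ρ w) +
        Real.exp (-v) * (response ρ (-w) - w * responseDeriv ρ (-w))) / 2) := by
  have hρ : ρ ^ 2 < 1 := (sq_lt_one_iff_abs_lt_one ρ).2 h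
  have hρ0 := sq_nonneg ρ
  set t := Real.tanh w with ht
  set T := Real.tanh v with hT
  have ht0 : 0 ≤ t := tanh_nonneg hw
  have ht1 : t < 1 := Real.tanh_lt_one w
  have htT : t ≤ T := tanh_mono hwv
  have hwt : w * (1 - t ^ 2) ≤ t := mul_one_sub_tanh_sq_le hw
  have ht2 : t ^ 2 < 1 := Real.tanh_sq_lt_one w
  have hq : 0 < 1 - ρ ^ 2 * t ^ 2 := by nlinarith [mul_nonneg hρ0 (sq_nonneg t)]
  have hc := Real.cosh_pos v
  have hS : Real.sinh v = T * Real.cosh v := by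
    rw [hT, Real.tanh_eq_sinh_div_cosh]; field_simp
  have key : (Real.exp v * (response ρ w + w * responseDeriv ρ w) +
        Real.exp (-v) * (response ρ (-w) - w * responseDeriv ρ (-w))) / 2 =
      (((1 - ρ ^ 2) * t * T + ρ ^ 2 * (1 - t ^ 2)) * (1 - ρ ^ 2 * t ^ 2) +
        w * (1 - t ^ 2) * (1 - ρ ^ 2) * ((1 + ρ ^ 2 * t ^ 2) * T - 2 * ρ ^ 2 * t)) /
        (1 - ρ ^ 2 * t ^ 2) ^ 2 * Real.cosh v := by
    rw [response_eq h, response_eq h, responseDeriv_eq h, responseDeriv_eq h, Real.tanh_neg, ← ht,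
      ← Real.cosh_add_sinh, ← Real.cosh_sub_sinh, hS, neg_sq]
    field_simp
    ring
  rw [key]
  have aux := symmetrised_bound_aux hρ ht0 ht1 htT hw hwt
  have hq1 : 1 - ρ ^ 2 * t ^ 2 ≤ 1 := by nlinarith [mul_nonneg hρ0 (sq_nonneg t)]
  constructor
  · gcongr
    rw [le_div_iff₀ (by positivity)]
    refine le_trans ?_ aux
    have : 0 ≤ ρ ^ 2 * (1 - t ^ 2) := by nlinarith
    rw [sq (1 - ρ ^ 2 * t ^ 2), ← mul_assoc]
    exact mul_le_of_le_one_right (by positivity) hq1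
  -- With `ρ² ≤ 1/2` the bracket multiplying `w` is at least `T - t ≥ 0` and can be dropped, while
  -- `1 - ρ² ≥ 1/2` keeps half of the product `t T`.
  · intro h2
    gcongr
    rw [le_div_iff₀ (by positivity)]
    have h3 : 0 ≤ w * (1 - t ^ 2) * (1 - ρ ^ 2) * ((1 + ρ ^ 2 * t ^ 2) * T - 2 * ρ ^ 2 * t) := by
      have h4 : 0 ≤ (1 + ρ ^ 2 * t ^ 2) * T - 2 * ρ ^ 2 * t := by
        nlinarith [mul_nonneg (mul_nonneg hρ0 (sq_nonneg t)) (ht0.trans htT)]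
      have h5 : 0 ≤ 1 - t ^ 2 := by linarith
      have h6 : 0 ≤ 1 - ρ ^ 2 := by linarith
      positivity
    have h7 : ρ ^ 2 * (1 - t ^ 2) + t * T / 2 ≤ (1 - ρ ^ 2) * t * T + ρ ^ 2 * (1 - t ^ 2) := by
      nlinarith [mul_nonneg ht0 (ht0.trans htT)]
    have h8 : 0 ≤ ρ ^ 2 * (1 - t ^ 2) + t * T / 2 := by
      have h5 : 0 ≤ 1 - t ^ 2 := by linarith
      have := ht0.trans htT
      positivity
    calc (ρ ^ 2 * (1 - t ^ 2) + t * T / 2) * (1 - ρ ^ 2 * t ^ 2) ^ 2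
        ≤ (ρ ^ 2 * (1 - t ^ 2) + t * T / 2) * (1 - ρ ^ 2 * t ^ 2) := by
          rw [sq (1 - ρ ^ 2 * t ^ 2), ← mul_assoc]
          exact mul_le_of_le_one_right (by positivity) hq1
      _ ≤ ((1 - ρ ^ 2) * t * T + ρ ^ 2 * (1 - t ^ 2)) * (1 - ρ ^ 2 * t ^ 2) := by gcongr
      _ ≤ _ := by linarith

/-- The odd part of `e^w · response w` is `sinh w`. -/
theorem exp_mul_response_sub (ρ : ℝ) (h : |ρ| < 1) (w : ℝ) :
    Real.exp w * response ρ w - Real.exp (-w) * response ρ (-w) = Real.exp w - Real.exp (-w) := by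
  have hρ : ρ ^ 2 < 1 := (sq_lt_one_iff_abs_lt_one ρ).2 h
  have ht2 := Real.tanh_sq_lt_one w
  have hq : 0 < 1 - ρ ^ 2 * Real.tanh w ^ 2 := by
    nlinarith [mul_nonneg (sq_nonneg ρ) (sq_nonneg (Real.tanh w))]
  have hc := Real.cosh_pos w
  have hS : Real.sinh w = Real.tanh w * Real.cosh w := by
    rw [Real.tanh_eq_sinh_div_cosh]; field_simp
  rw [response_eq h, response_eq h, Real.tanh_neg, ← Real.cosh_add_sinh, ← Real.cosh_sub_sinh, hS,
    neg_sq]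
  generalize Real.tanh w = t at hq ⊢
  have hq' : 1 - t ^ 2 * ρ ^ 2 ≠ 0 := by rw [mul_comm]; exact hq.ne'
  field_simp
  ring

/-! ### Integrals against the standard normal law -/

/-- The standard normal law on the line. -/
abbrev stdNormal : Measure ℝ := gaussianReal 0 1

theorem integrable_sq_stdNormal : Integrable (fun z : ℝ => z ^ 2) stdNormal :=
  (memLp_id_gaussianReal' (μ := 0) (v := 1) 2 (by simp)).integrable_sq

theorem integrable_id_stdNormal : Integrable (fun z : ℝ => z) stdNormal :=
  (memLp_id_gaussianReal' (μ := 0) (v := 1) 1 (by simp)).integrable le_rfl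

theorem integral_sq_stdNormal : ∫ z, z ^ 2 ∂stdNormal = 1 := by
  have h := variance_fun_id_gaussianReal (μ := 0) (v := 1)
  rw [variance_eq_integral (by fun_prop)] at h
  simpa [integral_id_gaussianReal] using h

theorem integrable_of_abs_le {ψ : ℝ → ℝ} (hψ : Continuous ψ) {a b : ℝ}
    (h : ∀ z, |ψ z| ≤ a + b * z ^ 2) : Integrable ψ stdNormal :=
  ((integrable_const a).add (integrable_sq_stdNormal.const_mul b)).mono'
    hψ.aestronglyMeasurable (ae_of_all _ h)

theorem integral_neg_stdNormal (ψ : ℝ → ℝ) : ∫ z, ψ (-z) ∂stdNormal = ∫ z, ψ z ∂stdNormal := by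
  have h : stdNormal.map (fun x => -x) = stdNormal := by simp [gaussianReal_map_neg]
  conv_rhs => rw [← h]
  exact ((Homeomorph.neg ℝ).measurableEmbedding.integral_map ψ).symm

theorem integrable_neg_stdNormal {ψ : ℝ → ℝ} (hψ : Integrable ψ stdNormal) :
    Integrable (fun z => ψ (-z)) stdNormal := by
  have h : stdNormal.map (fun x => -x) = stdNormal := by simp [gaussianReal_map_neg]
  rw [← h] at hψ
  exact hψ.comp_measurable measurable_neg

theorem integral_symmetrise {ψ : ℝ → ℝ} (hψ : Integrable ψ stdNormal) :
    ∫ z, ψ z ∂stdNormal = ∫ z, (ψ z + ψ (-z)) / 2 ∂stdNormal := by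
  rw [integral_div, integral_add hψ (integrable_neg_stdNormal hψ), integral_neg_stdNormal]
  ring

theorem gaussianPDFReal_std (x : ℝ) :
    gaussianPDFReal 0 1 x = (√(2 * Real.pi))⁻¹ * Real.exp (-(x ^ 2) / 2) := by
  simp [gaussianPDFReal]

/-- Change of measure for a shifted normal variable. -/
theorem integral_shift (ψ : ℝ → ℝ) (s : ℝ) :
    ∫ z, ψ (s + z) ∂stdNormal =
      Real.exp (-(s ^ 2) / 2) * ∫ z, Real.exp (s * z) * ψ z ∂stdNormal := by
  rw [integral_gaussianReal_eq_integral_smul one_ne_zero,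
    integral_gaussianReal_eq_integral_smul one_ne_zero, ← integral_const_mul,
    ← integral_add_left_eq_self
      (fun z => Real.exp (-(s ^ 2) / 2) * (gaussianPDFReal 0 1 z • (Real.exp (s * z) * ψ z))) s]
  refine integral_congr_ae (ae_of_all _ fun z => ?_)
  simp only [smul_eq_mul, gaussianPDFReal_std]
  have e : Real.exp (-(z ^ 2) / 2) = Real.exp (-(s ^ 2) / 2) * Real.exp (-((s + z) ^ 2) / 2) *
      Real.exp (s * (s + z)) := by
    rw [← Real.exp_add, ← Real.exp_add]; ring_nf
  rw [e]; ring

/-- Since `|z| ≤ e^z + e^{-z}`, the integrand is dominated by exponentials with exponents `s` and `s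
± 1`. -/
theorem integrable_exp_mul {ψ : ℝ → ℝ} (hψ : Continuous ψ) {a b : ℝ}
    (h : ∀ z, |ψ z| ≤ a + b * |z|) (s : ℝ) (hb : 0 ≤ b) :
    Integrable (fun z => Real.exp (s * z) * ψ z) stdNormal := by
  have h0 := integrable_exp_mul_gaussianReal (μ := 0) (v := 1) s
  have h1 := integrable_exp_mul_gaussianReal (μ := 0) (v := 1) (s + 1)
  have h2 := integrable_exp_mul_gaussianReal (μ := 0) (v := 1) (s - 1)
  refine ((h0.const_mul a).add ((h1.add h2).const_mul b)).mono' (by fun_prop)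
    (ae_of_all _ fun z => ?_)
  have hz : |z| ≤ Real.exp z + Real.exp (-z) := by
    have h3 := Real.add_one_le_exp z
    have h4 := Real.add_one_le_exp (-z)
    have h5 := Real.exp_pos z
    have h6 := Real.exp_pos (-z)
    rw [abs_le]; constructor <;> linarith
  simp only [Pi.add_apply, norm_mul, Real.norm_eq_abs, Real.abs_exp]
  have e1 : Real.exp ((s + 1) * z) = Real.exp (s * z) * Real.exp z := by
    rw [← Real.exp_add]; ring_nf
  have e2 : Real.exp ((s - 1) * z) = Real.exp (s * z) * Real.exp (-z) := by
    rw [← Real.exp_add]; ring_nf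
  rw [e1, e2]
  calc Real.exp (s * z) * |ψ z| ≤ Real.exp (s * z) * (a + b * (Real.exp z + Real.exp (-z))) := by
        gcongr; exact (h z).trans (by gcongr)
    _ = _ := by ring

/-- Stein's identity on the line. -/
theorem integral_mul_self_stdNormal {ψ ψ' : ℝ → ℝ} (hψ : ∀ z, HasDerivAt ψ (ψ' z) z)
    (h0 : Integrable ψ stdNormal) (h1 : Integrable (fun z => z * ψ z) stdNormal)
    (h2 : Integrable ψ' stdNormal) :
    ∫ z, z * ψ z ∂stdNormal = ∫ z, ψ' z ∂stdNormal := by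
  have hint : ∀ φ : ℝ → ℝ, Integrable φ stdNormal →
      Integrable (fun z => φ z * gaussianPDFReal 0 1 z) := by
    intro φ hφ
    rw [stdNormal, gaussianReal_of_var_ne_zero _ one_ne_zero,
      integrable_withDensity_iff (measurable_gaussianPDF _ _)
        (ae_of_all _ fun _ => gaussianPDF_lt_top)] at hφ
    simpa using hφ
  have hv : ∀ z, HasDerivAt (gaussianPDFReal 0 1) (-(z * gaussianPDFReal 0 1 z)) z := by
    intro z
    have h3 : gaussianPDFReal 0 1 = fun x => (√(2 * Real.pi))⁻¹ * Real.exp (-(x ^ 2) / 2) := by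
      funext x; exact gaussianPDFReal_std x
    rw [h3]
    have h4 := ((((hasDerivAt_id z).pow 2).neg.div_const 2).exp).const_mul (√(2 * Real.pi))⁻¹
    refine h4.congr_deriv ?_
    simp only [id, Pi.neg_apply, Pi.pow_apply]
    push_cast
    ring
  have h3 := integral_mul_deriv_eq_deriv_mul_of_integrable (u := ψ) (u' := ψ')
    (v := gaussianPDFReal 0 1) (v' := fun z => -(z * gaussianPDFReal 0 1 z))
    (fun z _ => hψ z) (fun z _ => hv z) ?_ (hint _ h2) (hint _ h0)
  · rw [integral_gaussianReal_eq_integral_smul one_ne_zero,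
      integral_gaussianReal_eq_integral_smul one_ne_zero]
    simp only [smul_eq_mul]
    have e1 : (fun z => gaussianPDFReal 0 1 z * (z * ψ z)) =
        fun z => -(ψ z * (-(z * gaussianPDFReal 0 1 z))) := by funext z; ring
    rw [e1, integral_neg, h3, neg_neg]
    exact integral_congr_ae (ae_of_all _ fun z => by ring)
  · have := (hint _ h1).neg
    refine this.congr (ae_of_all _ fun z => ?_)
    simp; ring

/-- Standard normal mass of `[1, 2]`. -/
def bandMass : ℝ := stdNormal.real (Set.Icc 1 2)

theorem bandMass_pos : 0 < bandMass := by
  refine ENNReal.toReal_pos (fun h => ?_) (measure_ne_top _ _)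
  have h1 := gaussianReal_absolutelyContinuous' 0 (one_ne_zero : (1 : NNReal) ≠ 0) h
  norm_num [Real.volume_Icc] at h1

/-- Quantitative lower bounds are thereby needed only for `z ∈ [1, 2]`, away from zero and infinity;
elsewhere nonnegativity suffices. -/
theorem bandMass_le_integral {ψ : ℝ → ℝ} (hi : Integrable ψ stdNormal) (h0 : ∀ z, 0 ≤ ψ z) {c : ℝ}
    (h : ∀ z, 1 ≤ z → z ≤ 2 → c ≤ ψ z) : c * bandMass ≤ ∫ z, ψ z ∂stdNormal := by
  calc c * bandMass = ∫ z in Set.Icc (1 : ℝ) 2, c ∂stdNormal := by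
        rw [setIntegral_const, bandMass, smul_eq_mul, mul_comm]
    _ ≤ ∫ z in Set.Icc (1 : ℝ) 2, ψ z ∂stdNormal :=
        setIntegral_mono_on (integrable_const _) hi.integrableOn measurableSet_Icc
          fun z hz => h z hz.1 hz.2
    _ ≤ _ := setIntegral_le_integral hi (ae_of_all _ h0)

/-! ### The one-dimensional population map -/

/-- The one-dimensional population map `𝔼[U tanh(α U + β_ρ)]` with `U` distributed as the mixture of
`N(± s, 1)` with weights `(1 ± ρ) / 2`. -/
def signalMap (ρ s α : ℝ) : ℝ := ∫ z, (s + z) * response ρ (α * (s + z)) ∂stdNormal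

theorem abs_add_le_sq (s z : ℝ) : |s + z| ≤ (|s| + 1) + 1 * z ^ 2 := by
  have h1 := abs_add_le s z
  have h2 : |z| ≤ 1 + z ^ 2 := by
    rw [abs_le]; constructor <;> nlinarith [sq_nonneg (z - 1), sq_nonneg (z + 1)]
  linarith

theorem integrable_signalMap {ρ : ℝ} (h : |ρ| < 1) (s α : ℝ) :
    Integrable (fun z => (s + z) * response ρ (α * (s + z))) stdNormal := by
  have hc := continuous_response ρ
  refine integrable_of_abs_le (a := |s| + 1) (b := 1) (by fun_prop) fun z => ?_
  rw [abs_mul]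
  calc _ ≤ |s + z| * 1 := by gcongr; exact abs_response_le h _
    _ ≤ _ := by rw [mul_one]; exact abs_add_le_sq s z

theorem integrable_exp_mul_signal {ρ : ℝ} (h : |ρ| < 1) (s α : ℝ) :
    Integrable (fun z => Real.exp (s * z) * (z * response ρ (α * z))) stdNormal := by
  have hc := continuous_response ρ
  refine integrable_exp_mul (a := 0) (b := 1) (by fun_prop) (fun z => ?_) s zero_le_one
  rw [abs_mul, zero_add, one_mul]
  exact mul_le_of_le_one_right (abs_nonneg z) (abs_response_le h _)

theorem signalMap_eq_exp (ρ s α : ℝ) : signalMap ρ s α = Real.exp (-(s ^ 2) / 2) *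
    ∫ z, Real.exp (s * z) * (z * response ρ (α * z)) ∂stdNormal :=
  integral_shift (fun y => y * response ρ (α * y)) s

/-- The true signal is a fixed point. -/
theorem signalMap_self {ρ : ℝ} (h : |ρ| < 1) (α : ℝ) : signalMap ρ α α = α := by
  rw [signalMap_eq_exp, integral_symmetrise (integrable_exp_mul_signal h α α)]
  have hi : Integrable (fun z => Real.exp (α * z) * z) stdNormal :=
    integrable_exp_mul (a := 0) (b := 1) continuous_id (fun z => by simp) α zero_le_one
  -- The tilt `e^{αz}` matches the argument of the response, so symmetrisation replaces the response
  -- by `1` (`exp_mul_response_sub`), and the mean of `N(α, 1)` remains.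
  have e : ∀ z : ℝ, (Real.exp (α * z) * (z * response ρ (α * z)) +
      Real.exp (α * -z) * (-z * response ρ (α * -z))) / 2 =
      (Real.exp (α * z) * z + Real.exp (α * -z) * -z) / 2 := by
    intro z
    have := exp_mul_response_sub ρ h (α * z)
    rw [mul_neg]
    linear_combination (z / 2) * this
  simp only [e]
  rw [← integral_symmetrise hi, ← integral_shift (fun z => z) α, integral_add (integrable_const _)
    integrable_id_stdNormal, integral_id_gaussianReal]
  simp

/-- For either sign of `u`, the integrand `u * response ρ (α u)` is nondecreasing in `α`. -/
theorem signalMap_mono {ρ : ℝ} (h : |ρ| < 1) (s : ℝ) : Monotone (signalMap ρ s) := by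
  intro a b hab
  refine integral_mono (integrable_signalMap h s a) (integrable_signalMap h s b) fun z => ?_
  rcases le_total 0 (s + z) with hz | hz
  · exact mul_le_mul_of_nonneg_left (response_mono h (by nlinarith)) hz
  · exact mul_le_mul_of_nonpos_left (response_mono h (by nlinarith)) hz

/-- The derivative of `y ↦ y * response ρ (α * y)`. -/
def signalIntegrandDeriv (ρ α y : ℝ) : ℝ :=
  response ρ (α * y) + α * y * responseDeriv ρ (α * y)

theorem continuous_signalIntegrandDeriv (ρ α : ℝ) : Continuous (signalIntegrandDeriv ρ α) := by
  have := continuous_response ρ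
  have := continuous_responseDeriv ρ
  unfold signalIntegrandDeriv
  fun_prop

theorem abs_signalIntegrandDeriv_le {ρ : ℝ} (h : |ρ| < 1) (α y : ℝ) :
    |signalIntegrandDeriv ρ α y| ≤ 1 + |α| * |y| := by
  unfold signalIntegrandDeriv
  refine (abs_add_le _ _).trans (add_le_add (abs_response_le h _) ?_)
  rw [abs_mul, abs_mul]
  exact mul_le_of_le_one_right (by positivity) (abs_responseDeriv_le h _)

theorem hasDerivAt_signalIntegrand (ρ α y : ℝ) :
    HasDerivAt (fun y => y * response ρ (α * y)) (signalIntegrandDeriv ρ α y) y := by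
  have h1 : HasDerivAt (fun y => α * y) α y := by simpa using (hasDerivAt_id y).const_mul α
  have h2 := (hasDerivAt_id y).mul ((hasDerivAt_response ρ (α * y)).comp y h1)
  refine h2.congr_deriv ?_
  simp only [signalIntegrandDeriv, id, Function.comp]
  ring

/-- The variable is the true signal `s`, with `α` held fixed. As `signalMap ρ α α = α`, integrating
this derivative from `s = α` to `s = η` gives the drift at `α`. -/
theorem hasDerivAt_signalMap {ρ : ℝ} (h : |ρ| < 1) (s α : ℝ) :
    HasDerivAt (fun s => signalMap ρ s α) (∫ z, signalIntegrandDeriv ρ α (s + z) ∂stdNormal) s := by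
  have hc := continuous_response ρ
  have hc' := continuous_signalIntegrandDeriv ρ α
  refine (hasDerivAt_integral_of_dominated_loc_of_deriv_le
    (F := fun s z => (s + z) * response ρ (α * (s + z)))
    (F' := fun s z => signalIntegrandDeriv ρ α (s + z))
    (bound := fun z => 1 + |α| * ((|s| + 2) + 1 * z ^ 2))
    (Metric.ball_mem_nhds s one_pos) (Filter.Eventually.of_forall fun x => ?_)
    (integrable_signalMap h s α) ?_ (ae_of_all _ fun z x hx => ?_) ?_
    (ae_of_all _ fun z x _ => ?_)).2
  · exact Continuous.aestronglyMeasurable (by fun_prop)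
  · exact Continuous.aestronglyMeasurable (by fun_prop)
  · refine (abs_signalIntegrandDeriv_le h α _).trans ?_
    gcongr
    refine (abs_add_le_sq x z).trans ?_
    have hx' : |x - s| < 1 := hx
    have : |x| ≤ |x - s| + |s| := by
      calc |x| = |(x - s) + s| := by ring_nf
        _ ≤ _ := abs_add_le _ _
    linarith
  · exact ((integrable_const _).add (((integrable_const _).add
      (integrable_sq_stdNormal.const_mul 1)).const_mul |α|))
  · exact (hasDerivAt_signalIntegrand ρ α (x + z)).comp_add_const x z

/-- The rate constant of the one-dimensional ascent estimate. -/
def ascentRate (C : ℝ) : ℝ :=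
  Real.exp (-(C ^ 2) / 2) * (1 / Real.cosh (2 * C) ^ 2 / (2 + 2 * C ^ 2)) * bandMass

theorem ascentRate_pos (C : ℝ) : 0 < ascentRate C := by
  have := bandMass_pos
  have := Real.cosh_pos (2 * C)
  unfold ascentRate
  positivity

theorem symmetrised_band_bound {ρ α s C z : ℝ} (h : |ρ| < 1) (hα : 0 ≤ α) (hαs : α ≤ s)
    (hs : s ≤ C) (hz1 : 1 ≤ z) (hz2 : z ≤ 2) :
    1 / Real.cosh (2 * C) ^ 2 / (2 + 2 * C ^ 2) * (ρ ^ 2 + α * s) ≤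
      (Real.exp (s * z) * signalIntegrandDeriv ρ α z +
        Real.exp (s * -z) * signalIntegrandDeriv ρ α (-z)) / 2 := by
  have hz0 : 0 ≤ z := by linarith
  have hs0 : 0 ≤ s := hα.trans hαs
  have hsz : s * z ≤ 2 * C := by nlinarith
  have hαz : α * z ≤ s * z := by gcongr
  have key := symmetrised_lower_bound (w := α * z) (v := s * z) h (by positivity) hαz
  have e : (Real.exp (s * z) * signalIntegrandDeriv ρ α z +
        Real.exp (s * -z) * signalIntegrandDeriv ρ α (-z)) / 2 =
      (Real.exp (s * z) * (response ρ (α * z) + α * z * responseDeriv ρ (α * z)) +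
        Real.exp (-(s * z)) * (response ρ (-(α * z)) - α * z * responseDeriv ρ (-(α * z)))) / 2 := by
    simp only [signalIntegrandDeriv, mul_neg]
    ring
  rw [e]
  have hcosh := Real.one_le_cosh (s * z)
  have hC := Real.cosh_pos (2 * C)
  set x := 1 / Real.cosh (2 * C) ^ 2 with hx
  have hx0 : 0 < x := by positivity
  have hx1 : x ≤ 1 - Real.tanh (α * z) ^ 2 := by
    rw [one_sub_tanh_sq, hx]
    have : Real.cosh (α * z) ≤ Real.cosh (2 * C) := by
      rw [Real.cosh_le_cosh, abs_of_nonneg (by positivity), abs_of_nonneg (by linarith)]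
      linarith
    have := Real.cosh_pos (α * z)
    gcongr
  by_cases h2 : 2 * ρ ^ 2 ≤ 1
  · refine le_trans ?_ (key.2 h2)
    have ht1 := div_cosh_le_tanh (x := α * z) (R := 2 * C) (by positivity) (hαz.trans hsz)
    have ht2 := div_cosh_le_tanh (x := s * z) (R := 2 * C) (by positivity) hsz
    have ht3 : x * (α * s) ≤ Real.tanh (α * z) * Real.tanh (s * z) := by
      calc x * (α * s) ≤ x * ((α * z) * (s * z)) := by
            gcongr
            · nlinarith
            · nlinarith
        _ = (α * z / Real.cosh (2 * C)) * (s * z / Real.cosh (2 * C)) := by rw [hx]; field_simp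
        _ ≤ _ := by
            have := tanh_nonneg (by positivity : 0 ≤ α * z)
            gcongr
    have ht4 : ρ ^ 2 * x ≤ ρ ^ 2 * (1 - Real.tanh (α * z) ^ 2) := by gcongr
    have ht5 : x / (2 + 2 * C ^ 2) ≤ x / 2 := by
      gcongr; nlinarith [sq_nonneg C]
    have ht6 : 0 ≤ ρ ^ 2 + α * s := by positivity
    have ht7 : 0 ≤ x * (α * s) := by positivity
    have ht8 : 0 ≤ ρ ^ 2 * x := by positivity
    calc x / (2 + 2 * C ^ 2) * (ρ ^ 2 + α * s) ≤ x / 2 * (ρ ^ 2 + α * s) := by gcongr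
      _ ≤ ρ ^ 2 * (1 - Real.tanh (α * z) ^ 2) + Real.tanh (α * z) * Real.tanh (s * z) / 2 := by
          nlinarith
      _ ≤ _ := le_mul_of_one_le_right (by linarith) hcosh
  -- For `ρ² > 1/2` the `ρ²` term alone suffices, because `α s ≤ C² ≤ 2 C² ρ²`; this is the origin
  -- of the denominator `2 + 2 C²`.
  · refine le_trans ?_ key.1
    push Not at h2
    have hαs2 : α * s ≤ C ^ 2 := by nlinarith
    have h3 : ρ ^ 2 + α * s ≤ (2 + 2 * C ^ 2) * ρ ^ 2 := by nlinarith [sq_nonneg C]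
    calc x / (2 + 2 * C ^ 2) * (ρ ^ 2 + α * s)
        ≤ x / (2 + 2 * C ^ 2) * ((2 + 2 * C ^ 2) * ρ ^ 2) := by gcongr
      _ = ρ ^ 2 * x := by field_simp
      _ ≤ ρ ^ 2 * (1 - Real.tanh (α * z) ^ 2) := by gcongr
      _ ≤ _ := le_mul_of_one_le_right (by nlinarith [sq_nonneg ρ]) hcosh

theorem symmetrised_nonneg {ρ α s : ℝ} (h : |ρ| < 1) (hα : 0 ≤ α) (hαs : α ≤ s) (z : ℝ) :
    0 ≤ (Real.exp (s * z) * signalIntegrandDeriv ρ α z +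
        Real.exp (s * -z) * signalIntegrandDeriv ρ α (-z)) / 2 := by
  wlog hz : 0 ≤ z generalizing z
  · have := this (-z) (by linarith)
    rw [neg_neg] at this
    linarith
  have key := (symmetrised_lower_bound (w := α * z) (v := s * z) h (by positivity)
    (by gcongr)).1
  have h1 : 0 ≤ ρ ^ 2 * (1 - Real.tanh (α * z) ^ 2) * Real.cosh (s * z) := by
    have := Real.tanh_sq_lt_one (α * z)
    have := Real.cosh_pos (s * z)
    have : 0 ≤ 1 - Real.tanh (α * z) ^ 2 := by linarith
    positivity
  refine h1.trans (key.trans (le_of_eq ?_))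
  simp only [signalIntegrandDeriv, mul_neg]
  ring

theorem ascentRate_le_integral {ρ α s C : ℝ} (h : |ρ| < 1) (hα : 0 ≤ α) (hαs : α ≤ s)
    (hs : s ≤ C) :
    ascentRate C * (ρ ^ 2 + α * s) ≤ ∫ z, signalIntegrandDeriv ρ α (s + z) ∂stdNormal := by
  have hi : Integrable (fun z => Real.exp (s * z) * signalIntegrandDeriv ρ α z) stdNormal :=
    integrable_exp_mul (continuous_signalIntegrandDeriv ρ α)
      (abs_signalIntegrandDeriv_le h α) s (abs_nonneg α)
  have hi2 : Integrable (fun z => (Real.exp (s * z) * signalIntegrandDeriv ρ α z +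
      Real.exp (s * -z) * signalIntegrandDeriv ρ α (-z)) / 2) stdNormal :=
    (hi.add (integrable_neg_stdNormal hi)).div_const 2
  rw [integral_shift (signalIntegrandDeriv ρ α) s, integral_symmetrise hi]
  have h1 := bandMass_le_integral hi2 (symmetrised_nonneg h hα hαs)
    (fun z h1 h2 => symmetrised_band_bound h hα hαs hs h1 h2)
  have hs0 : 0 ≤ s := hα.trans hαs
  have h2 : Real.exp (-(C ^ 2) / 2) ≤ Real.exp (-(s ^ 2) / 2) := by
    rw [Real.exp_le_exp]; nlinarith
  have h3 : 0 ≤ 1 / Real.cosh (2 * C) ^ 2 / (2 + 2 * C ^ 2) * (ρ ^ 2 + α * s) * bandMass := by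
    have := bandMass_pos
    positivity
  calc ascentRate C * (ρ ^ 2 + α * s) = Real.exp (-(C ^ 2) / 2) *
        (1 / Real.cosh (2 * C) ^ 2 / (2 + 2 * C ^ 2) * (ρ ^ 2 + α * s) * bandMass) := by
        unfold ascentRate; ring
    _ ≤ _ := by gcongr

/-- Below the true signal, the population map moves up. -/
theorem ascent_le_signalMap_sub {ρ α η C : ℝ} (h : |ρ| < 1) (hα : 0 ≤ α) (hαη : α ≤ η)
    (hη : η ≤ C) :
    ascentRate C / 2 * (ρ ^ 2 + α * η) * (η - α) ≤ signalMap ρ η α - α := by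
  set k := ascentRate C
  have hk := ascentRate_pos C
  have hd : ∀ s, HasDerivAt (fun s => signalMap ρ s α - k * (ρ ^ 2 * s + α * s ^ 2 / 2))
      ((∫ z, signalIntegrandDeriv ρ α (s + z) ∂stdNormal) - k * (ρ ^ 2 + α * s)) s := by
    intro s
    refine (hasDerivAt_signalMap h s α).sub ?_
    have h1 := (((hasDerivAt_id s).const_mul (ρ ^ 2)).add
      ((((hasDerivAt_id s).pow 2).const_mul α).div_const 2)).const_mul k
    refine h1.congr_deriv ?_
    simp only [id]
    push_cast
    ring
  -- The subtracted polynomial is an antiderivative in `s` of the bound from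
  -- `ascentRate_le_integral`; the endpoints of `[α, η]` are then compared.
  have hm : MonotoneOn (fun s => signalMap ρ s α - k * (ρ ^ 2 * s + α * s ^ 2 / 2))
      (Set.Icc α η) := by
    refine monotoneOn_of_deriv_nonneg (convex_Icc α η)
      (fun s _ => (hd s).continuousAt.continuousWithinAt)
      (fun s _ => (hd s).differentiableAt.differentiableWithinAt) fun s hs => ?_
    rw [interior_Icc] at hs
    rw [(hd s).deriv, sub_nonneg]
    exact ascentRate_le_integral h hα hs.1.le (hs.2.le.trans hη)
  have h1 := hm (Set.left_mem_Icc.2 hαη) (Set.right_mem_Icc.2 hαη) hαη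
  simp only [signalMap_self h] at h1
  have h2 : ρ ^ 2 * (η - α) + α * (η ^ 2 - α ^ 2) / 2 ≥ (ρ ^ 2 + α * η) * (η - α) / 2 := by
    have h3 : 0 ≤ ρ ^ 2 * (η - α) := mul_nonneg (sq_nonneg _) (by linarith)
    have h4 : 0 ≤ α * α * (η - α) := mul_nonneg (by positivity) (by linarith)
    nlinarith
  nlinarith [mul_le_mul_of_nonneg_left h2.le hk.le]

/-! ### Contraction above the true signal -/

/-- A form of `sech²(w + β)`, as `cosh (w + β) = (cosh w + ρ sinh w) / √(1 - ρ²)`. -/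
theorem one_sub_tanh_add_beta_sq {ρ : ℝ} (h : |ρ| < 1) (w : ℝ) :
    (1 - Real.tanh (w + beta ρ) ^ 2) * (Real.cosh w + ρ * Real.sinh w) ^ 2 = 1 - ρ ^ 2 := by
  have hc := Real.cosh_pos w
  have h1 := (one_add_mul_pos h (Real.abs_tanh_lt_one w)).ne'
  have hS : Real.sinh w = Real.tanh w * Real.cosh w := by
    rw [Real.tanh_eq_sinh_div_cosh]; field_simp
  have hC : (1 - Real.tanh w ^ 2) * Real.cosh w ^ 2 = 1 := by
    rw [one_sub_tanh_sq]; field_simp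
  rw [tanh_add_beta h, hS]
  have e : Real.cosh w + ρ * (Real.tanh w * Real.cosh w) =
      (1 + Real.tanh w * ρ) * Real.cosh w := by ring
  rw [e]
  have e2 : (1 - ((Real.tanh w + ρ) / (1 + Real.tanh w * ρ)) ^ 2) * (1 + Real.tanh w * ρ) ^ 2 =
      (1 - Real.tanh w ^ 2) * (1 - ρ ^ 2) := by
    rw [sub_mul, div_pow, div_mul_cancel₀ _ (pow_ne_zero 2 h1)]; ring
  calc _ = ((1 - ((Real.tanh w + ρ) / (1 + Real.tanh w * ρ)) ^ 2) * (1 + Real.tanh w * ρ) ^ 2) *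
        Real.cosh w ^ 2 := by ring
    _ = _ := by rw [e2]; linear_combination (1 - ρ ^ 2) * hC

/-- Let `G x = cosh x + ρ sinh x`, convex with `G 0 = 1` and `G² ≥ 1 - ρ²`. If `G v ≤ 1` the minimum
of `G²` suffices. Otherwise, `v` lying between `0` and `w`, convexity forces `G w ≥ G v > 1`. -/
theorem tilt_le_sq {ρ v w : ℝ} (h0 : 0 ≤ ρ) (h : ρ < 1) {l : ℝ} (hl0 : 0 ≤ l) (hl1 : l ≤ 1)
    (hv : v = l * w) :
    (1 - ρ ^ 2) * (Real.cosh v + ρ * Real.sinh v) ≤ (Real.cosh w + ρ * Real.sinh w) ^ 2 := by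
  have hconv : ConvexOn ℝ Set.univ (fun x => Real.cosh x + ρ * Real.sinh x) := by
    have e : (fun x => Real.cosh x + ρ * Real.sinh x) =
        fun x => (1 + ρ) / 2 * Real.exp x + (1 - ρ) / 2 * Real.exp (-x) := by
      funext x; rw [Real.cosh_eq, Real.sinh_eq]; ring
    rw [e]
    have h1 : ConvexOn ℝ Set.univ (fun x : ℝ => Real.exp (-x)) := by
      have := convexOn_exp.comp_linearMap (-LinearMap.id : ℝ →ₗ[ℝ] ℝ)
      simpa [Function.comp_def] using this
    have h2 := (convexOn_exp.smul (by linarith : 0 ≤ (1 + ρ) / 2)).add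
      (h1.smul (by linarith : 0 ≤ (1 - ρ) / 2))
    exact h2
  have hc := hconv.2 (Set.mem_univ w) (Set.mem_univ 0) hl0 (by linarith : 0 ≤ 1 - l) (by ring)
  simp only [smul_eq_mul, mul_zero, add_zero, Real.cosh_zero, Real.sinh_zero, mul_one, ← hv] at hc
  set a := Real.cosh v + ρ * Real.sinh v
  set b := Real.cosh w + ρ * Real.sinh w with hb
  have hb2 : 1 - ρ ^ 2 ≤ b ^ 2 := by
    nlinarith [sq_nonneg (Real.sinh w + ρ * Real.cosh w), Real.cosh_sq w]
  have hr : 0 < 1 - ρ ^ 2 := by nlinarith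
  rcases le_or_gt a 1 with ha | ha
  · nlinarith
  · have hab : a ≤ b := by
      by_contra hlt
      push Not at hlt
      rcases hl0.eq_or_lt with hl | hl
      · rw [← hl] at hc
        linarith
      · nlinarith
    nlinarith

/-- The weight is, up to `e^{-η²/2}`, the density of the mixture relative to the standard normal.
For `a ≥ η`, `tilt_le_sq` shows that its product with `sech²(a z + β)` is at most `1`, so the
derivative in `a` is at most `z²`. -/
theorem tilt_mul_tanh_sub_le {ρ η α : ℝ} (h0 : 0 ≤ ρ) (h : ρ < 1) (hη : 0 ≤ η) (hηα : η ≤ α)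
    (z : ℝ) :
    z * ((1 + ρ) / 2 * Real.exp (η * z) + (1 - ρ) / 2 * Real.exp (-(η * z))) *
      (Real.tanh (α * z + beta ρ) - Real.tanh (η * z + beta ρ)) ≤ z ^ 2 * (α - η) := by
  have hρ : |ρ| < 1 := abs_lt.2 ⟨by linarith, h⟩
  have e : (1 + ρ) / 2 * Real.exp (η * z) + (1 - ρ) / 2 * Real.exp (-(η * z)) =
      Real.cosh (η * z) + ρ * Real.sinh (η * z) := by
    rw [Real.cosh_eq, Real.sinh_eq]; ring
  rw [e]
  set W := Real.cosh (η * z) + ρ * Real.sinh (η * z) with hW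
  have hd : ∀ a, HasDerivAt (fun a => z * W * Real.tanh (a * z + beta ρ))
      (z * W * ((1 - Real.tanh (a * z + beta ρ) ^ 2) * z)) a := by
    intro a
    have h1 : HasDerivAt (fun a => a * z + beta ρ) z a := by
      simpa using ((hasDerivAt_id a).mul_const z).add_const (beta ρ)
    exact ((hasDerivAt_tanh (a * z + beta ρ)).comp a h1).const_mul (z * W)
  have key := (convex_Icc η α).image_sub_le_mul_sub_of_deriv_le
    (f := fun a => z * W * Real.tanh (a * z + beta ρ)) (C := z ^ 2)
    (fun s _ => (hd s).continuousAt.continuousWithinAt)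
    (fun s _ => (hd s).differentiableAt.differentiableWithinAt) ?_
    η (Set.left_mem_Icc.2 hηα) α (Set.right_mem_Icc.2 hηα) hηα
  · simpa [mul_sub] using key
  · intro a ha
    rw [interior_Icc] at ha
    rw [(hd a).deriv]
    have ha0 : 0 < a := hη.trans_lt ha.1
    have h1 := tilt_le_sq (v := η * z) (w := a * z) h0 h (l := η / a) (by positivity)
      ((div_le_one ha0).2 ha.1.le) (by field_simp)
    have h2 := one_sub_tanh_add_beta_sq hρ (a * z)
    have h3 : 0 < 1 - ρ ^ 2 := by nlinarith
    set c := Real.cosh (a * z) + ρ * Real.sinh (a * z)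
    set x := 1 - Real.tanh (a * z + beta ρ) ^ 2
    have hx : 0 < x := sub_pos.2 (Real.tanh_sq_lt_one _)
    have h4 : W * x ≤ 1 := by
      have : (1 - ρ ^ 2) * (W * x) ≤ (1 - ρ ^ 2) * 1 := by
        calc (1 - ρ ^ 2) * (W * x) = ((1 - ρ ^ 2) * W) * x := by ring
          _ ≤ c ^ 2 * x := by gcongr
          _ = _ := by linarith
      exact le_of_mul_le_mul_left this h3
    nlinarith [mul_le_mul_of_nonneg_left h4 (sq_nonneg z)]

/-- Above the true signal, the population map contracts. -/
theorem signalMap_sub_le {ρ η α : ℝ} (h0 : 0 ≤ ρ) (h : ρ < 1) (hη : 0 ≤ η) (hηα : η ≤ α) :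
    signalMap ρ η α - η ≤ Real.exp (-(η ^ 2) / 2) * (α - η) := by
  have hρ : |ρ| < 1 := abs_lt.2 ⟨by linarith, h⟩
  have hi := (integrable_exp_mul_signal hρ η α).sub (integrable_exp_mul_signal hρ η η)
  have e1 : signalMap ρ η α - η = Real.exp (-(η ^ 2) / 2) *
      ∫ z, (Real.exp (η * z) * (z * response ρ (α * z)) -
        Real.exp (η * z) * (z * response ρ (η * z))) ∂stdNormal := by
    rw [integral_sub (integrable_exp_mul_signal hρ η α) (integrable_exp_mul_signal hρ η η), mul_sub,
      ← signalMap_eq_exp, ← signalMap_eq_exp, signalMap_self hρ]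
  rw [e1]
  gcongr
  have hi' : Integrable (fun z => Real.exp (η * z) * (z * response ρ (α * z)) -
        Real.exp (η * z) * (z * response ρ (η * z))) stdNormal := hi
  rw [integral_symmetrise hi']
  have hi2 := (hi'.add (integrable_neg_stdNormal hi')).div_const 2
  calc _ ≤ ∫ z, z ^ 2 * (α - η) ∂stdNormal := by
        refine integral_mono hi2 (integrable_sq_stdNormal.mul_const _) fun z => ?_
        have p1 := tilt_mul_tanh_sub_le h0 h hη hηα z
        have p2 := tilt_mul_tanh_sub_le h0 h hη hηα (-z)
        have t1 : ∀ a, Real.tanh (a * -z - beta ρ) = -Real.tanh (a * z + beta ρ) := by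
          intro a; rw [← Real.tanh_neg]; ring_nf
        have t2 : ∀ a, Real.tanh (a * -z + beta ρ) = -Real.tanh (a * z - beta ρ) := by
          intro a; rw [← Real.tanh_neg]; ring_nf
        rw [t2, t2] at p2
        simp only [response, t1, t2]
        simp only [mul_neg, neg_neg, neg_sq] at p2 ⊢
        nlinarith
    _ = α - η := by rw [integral_mul_const, integral_sq_stdNormal, one_mul]

theorem exp_neg_half_sq_le {η C : ℝ} (hη0 : 0 ≤ η) (hη : η ≤ C) :
    Real.exp (-(η ^ 2) / 2) ≤ 1 - Real.exp (-(C ^ 2) / 2) / 2 * η ^ 2 := by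
  have h1 : Real.exp (-(C ^ 2) / 2) ≤ Real.exp (-(η ^ 2) / 2) := by
    rw [Real.exp_le_exp]; nlinarith
  have h2 := Real.add_one_le_exp (η ^ 2 / 2)
  have h3 : Real.exp (-(η ^ 2) / 2) * Real.exp (η ^ 2 / 2) = 1 := by
    rw [← Real.exp_add]; ring_nf; simp
  have h4 := mul_le_mul_of_nonneg_left h2 (Real.exp_pos (-(η ^ 2) / 2)).le
  nlinarith [mul_le_mul_of_nonneg_right h1 (sq_nonneg η)]

/-! ### The two coefficients of the population map -/

/-- The coefficient of the true parameter in the population map. -/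
def meanCoef (ρ m τ : ℝ) : ℝ := ∫ z, response ρ (m + τ * z) ∂stdNormal

/-- The coefficient of the current parameter in the population map. -/
def selfCoef (ρ m τ : ℝ) : ℝ := ∫ z, responseDeriv ρ (m + τ * z) ∂stdNormal

theorem integrable_comp_affine {ψ : ℝ → ℝ} (hψ : Continuous ψ) {K : ℝ} (h : ∀ w, |ψ w| ≤ K)
    (m τ : ℝ) : Integrable (fun z => ψ (m + τ * z)) stdNormal :=
  integrable_of_abs_le (a := K) (b := 0) (by fun_prop) fun z => by simpa using h _

/-- Stein's identity for the response. -/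
theorem integral_mul_response {ρ : ℝ} (h : |ρ| < 1) (m τ : ℝ) :
    ∫ z, z * response ρ (m + τ * z) ∂stdNormal = τ * selfCoef ρ m τ := by
  have hc := continuous_response ρ
  rw [selfCoef, ← integral_const_mul]
  refine integral_mul_self_stdNormal (ψ := fun z => response ρ (m + τ * z)) (fun z => ?_)
    (integrable_comp_affine hc (abs_response_le h) m τ) ?_
    ((integrable_comp_affine (continuous_responseDeriv ρ) (abs_responseDeriv_le h) m τ).const_mul τ)
  · have h1 : HasDerivAt (fun z => m + τ * z) τ z := by
      simpa using ((hasDerivAt_id z).const_mul τ).const_add m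
    refine ((hasDerivAt_response ρ (m + τ * z)).comp z h1).congr_deriv (mul_comm _ _)
  · refine integrable_of_abs_le (a := 1) (b := 1) (by fun_prop) fun z => ?_
    rw [abs_mul]
    refine (mul_le_of_le_one_right (abs_nonneg z) (abs_response_le h _)).trans ?_
    have := abs_add_le_sq 0 z
    simpa using this

theorem signalMap_eq {ρ : ℝ} (h : |ρ| < 1) (η α : ℝ) :
    signalMap ρ η α = meanCoef ρ (η * α) α * η + selfCoef ρ (η * α) α * α := by
  have hi := integrable_comp_affine (continuous_response ρ) (abs_response_le h) (η * α) α
  have hi2 := (integrable_signalMap h η α).sub (hi.const_mul η)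
  have e : (fun z => (η + z) * response ρ (α * (η + z))) - (fun z => η * response ρ (η * α + α * z))
      = fun z => z * response ρ (η * α + α * z) := by
    funext z
    simp only [Pi.sub_apply]
    rw [show α * (η + z) = η * α + α * z by ring]; ring
  rw [e] at hi2
  have e2 : signalMap ρ η α = ∫ z, (η * response ρ (η * α + α * z) +
      z * response ρ (η * α + α * z)) ∂stdNormal := by
    refine integral_congr_ae (ae_of_all _ fun z => ?_)
    simp only []
    rw [show α * (η + z) = η * α + α * z by ring]; ring
  rw [e2, integral_add (hi.const_mul η) hi2, integral_const_mul, integral_mul_response h, meanCoef]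
  ring

/-! ### Regularity of the coefficients -/

theorem abs_sub_le_of_hasDerivAt {ψ ψ' : ℝ → ℝ} (h : ∀ x, HasDerivAt ψ (ψ' x) x) {M : ℝ}
    (hM : ∀ x, |ψ' x| ≤ M) (x y : ℝ) : |ψ x - ψ y| ≤ M * |x - y| := by
  have := convex_univ.norm_image_sub_le_of_norm_hasDerivWithin_le (f := ψ) (f' := ψ') (C := M)
    (fun x _ => (h x).hasDerivWithinAt) (fun x _ => hM x) (Set.mem_univ y) (Set.mem_univ x)
  simpa using this

/-- The even function `x ↦ ψ (m + x) + ψ (m - x)` has derivative at most `2 M x` in absolute value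
for `x ≥ 0`, so its increments are dominated by those of `M x²`. -/
theorem abs_symmetric_sum_sub_le {ψ ψ' ψ'' : ℝ → ℝ} (h1 : ∀ x, HasDerivAt ψ (ψ' x) x)
    (h2 : ∀ x, HasDerivAt ψ' (ψ'' x) x) {M : ℝ} (hM : ∀ x, |ψ'' x| ≤ M) (m a b : ℝ) :
    |(ψ (m + a) + ψ (m - a)) - (ψ (m + b) + ψ (m - b))| ≤ M * |a ^ 2 - b ^ 2| := by
  have even : ∀ a, ψ (m + a) + ψ (m - a) = ψ (m + |a|) + ψ (m - |a|) := by
    intro a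
    rcases abs_cases a with ⟨h, _⟩ | ⟨h, _⟩ <;> rw [h]
    rw [sub_neg_eq_add, ← sub_eq_add_neg, add_comm]
  rw [even a, even b, ← sq_abs a, ← sq_abs b]
  generalize ha : |a| = a'
  generalize hb : |b| = b'
  have ha0 : 0 ≤ a' := ha ▸ abs_nonneg a
  have hb0 : 0 ≤ b' := hb ▸ abs_nonneg b
  clear ha hb
  wlog hab : b' ≤ a' generalizing a' b'
  · have := this b' a' hb0 ha0 (by linarith)
    rw [abs_sub_comm, abs_sub_comm (a' ^ 2)]
    exact this
  have hd : ∀ x, HasDerivAt (fun x => ψ (m + x) + ψ (m - x)) (ψ' (m + x) - ψ' (m - x)) x := by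
    intro x
    have e1 := (h1 (m + x)).comp_const_add m x
    have e2 := (h1 (m - x)).comp_const_sub m x
    exact (e1.add e2).congr_deriv (by ring)
  have hs : ∀ x, HasDerivAt (fun x => M * x ^ 2) (M * (2 * x)) x := by
    intro x
    simpa using ((hasDerivAt_id x).pow 2).const_mul M
  have hbd : ∀ x, 0 ≤ x → |ψ' (m + x) - ψ' (m - x)| ≤ M * (2 * x) := by
    intro x hx
    have := abs_sub_le_of_hasDerivAt h2 hM (m + x) (m - x)
    rwa [show m + x - (m - x) = 2 * x by ring, abs_of_nonneg (by linarith : 0 ≤ 2 * x)] at this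
  have m1 : MonotoneOn (fun x => M * x ^ 2 - (ψ (m + x) + ψ (m - x))) (Set.Ici 0) := by
    refine monotoneOn_of_deriv_nonneg (convex_Ici 0)
      (fun x _ => ((hs x).sub (hd x)).continuousAt.continuousWithinAt)
      (fun x _ => ((hs x).sub (hd x)).differentiableAt.differentiableWithinAt) fun x hx => ?_
    rw [interior_Ici] at hx
    refine le_of_le_of_eq ?_ ((hs x).sub (hd x)).deriv.symm
    linarith [(abs_le.1 (hbd x (le_of_lt hx))).2]
  have m2 : MonotoneOn (fun x => M * x ^ 2 + (ψ (m + x) + ψ (m - x))) (Set.Ici 0) := by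
    refine monotoneOn_of_deriv_nonneg (convex_Ici 0)
      (fun x _ => ((hs x).add (hd x)).continuousAt.continuousWithinAt)
      (fun x _ => ((hs x).add (hd x)).differentiableAt.differentiableWithinAt) fun x hx => ?_
    rw [interior_Ici] at hx
    refine le_of_le_of_eq ?_ ((hs x).add (hd x)).deriv.symm
    linarith [(abs_le.1 (hbd x (le_of_lt hx))).1]
  have k1 := m1 hb0 ha0 hab
  have k2 := m2 hb0 ha0 hab
  simp only [] at k1 k2
  rw [abs_of_nonneg (by nlinarith : 0 ≤ a' ^ 2 - b' ^ 2), abs_le]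
  constructor <;> linarith

/-- Symmetry of the normal law makes the dependence on `τ` Lipschitz in `τ²`. This is why the
orthogonal component disturbs the signal only at second order. -/
theorem abs_integral_affine_sub_le {ψ ψ' ψ'' : ℝ → ℝ} (h1 : ∀ x, HasDerivAt ψ (ψ' x) x)
    (h2 : ∀ x, HasDerivAt ψ' (ψ'' x) x) {K M : ℝ} (hK : ∀ x, |ψ x| ≤ K) (hM1 : ∀ x, |ψ' x| ≤ M)
    (hM2 : ∀ x, |ψ'' x| ≤ M) (m m' τ τ' : ℝ) :
    |(∫ z, ψ (m + τ * z) ∂stdNormal) - ∫ z, ψ (m' + τ' * z) ∂stdNormal| ≤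
      M * (|m - m'| + |τ ^ 2 - τ' ^ 2|) := by
  have hc : Continuous ψ := continuous_iff_continuousAt.2 fun x => (h1 x).continuousAt
  have hi := integrable_comp_affine hc hK
  have hM0 : 0 ≤ M := (abs_nonneg _).trans (hM1 0)
  have s1 : |(∫ z, ψ (m + τ * z) ∂stdNormal) - ∫ z, ψ (m' + τ * z) ∂stdNormal| ≤ M * |m - m'| := by
    rw [← integral_sub (hi m τ) (hi m' τ)]
    have := norm_integral_le_of_norm_le_const (μ := stdNormal)
      (f := fun z => ψ (m + τ * z) - ψ (m' + τ * z)) (C := M * |m - m'|) (ae_of_all _ fun z => by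
        have := abs_sub_le_of_hasDerivAt h1 hM1 (m + τ * z) (m' + τ * z)
        simpa using this)
    simpa using this
  have s2 : |(∫ z, ψ (m' + τ * z) ∂stdNormal) - ∫ z, ψ (m' + τ' * z) ∂stdNormal| ≤
      M * |τ ^ 2 - τ' ^ 2| := by
    have hi2 : Integrable (fun z => ψ (m' + τ * z) - ψ (m' + τ' * z)) stdNormal :=
      (hi m' τ).sub (hi m' τ')
    rw [← integral_sub (hi m' τ) (hi m' τ'), integral_symmetrise hi2]
    have := norm_integral_le_of_norm_le (μ := stdNormal)
      (f := fun z => ((ψ (m' + τ * z) - ψ (m' + τ' * z)) +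
        (ψ (m' + τ * -z) - ψ (m' + τ' * -z))) / 2)
      (g := fun z => M * |τ ^ 2 - τ' ^ 2| * z ^ 2) (integrable_sq_stdNormal.const_mul _)
      (ae_of_all _ fun z => by
        have := abs_symmetric_sum_sub_le h1 h2 hM2 m' (τ * z) (τ' * z)
        have e : (τ * z) ^ 2 - (τ' * z) ^ 2 = (τ ^ 2 - τ' ^ 2) * z ^ 2 := by ring
        rw [e, abs_mul, abs_of_nonneg (sq_nonneg z), ← mul_assoc] at this
        have e2 : (ψ (m' + τ * z) - ψ (m' + τ' * z)) + (ψ (m' + τ * -z) - ψ (m' + τ' * -z)) =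
          (ψ (m' + τ * z) + ψ (m' - τ * z)) - (ψ (m' + τ' * z) + ψ (m' - τ' * z)) := by
          simp only [mul_neg, ← sub_eq_add_neg]; ring
        rw [e2, Real.norm_eq_abs, abs_div, abs_two]
        have h0 := abs_nonneg ((ψ (m' + τ * z) + ψ (m' - τ * z)) -
          (ψ (m' + τ' * z) + ψ (m' - τ' * z)))
        linarith)
    rwa [integral_const_mul, integral_sq_stdNormal, mul_one] at this
  calc _ ≤ |(∫ z, ψ (m + τ * z) ∂stdNormal) - ∫ z, ψ (m' + τ * z) ∂stdNormal| +
        |(∫ z, ψ (m' + τ * z) ∂stdNormal) - ∫ z, ψ (m' + τ' * z) ∂stdNormal| := abs_sub_le _ _ _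
    _ ≤ _ := by linarith

/-- The weighted average of `φ (w ± β_ρ)` with weights `(1 ± ρ) / 2`. -/
def average (ρ : ℝ) (φ : ℝ → ℝ) (w : ℝ) : ℝ :=
  (1 + ρ) / 2 * φ (w + beta ρ) + (1 - ρ) / 2 * φ (w - beta ρ)

theorem abs_average_le {ρ : ℝ} (h : |ρ| < 1) {φ : ℝ → ℝ} {M : ℝ} (hM : ∀ x, |φ x| ≤ M) (w : ℝ) :
    |average ρ φ w| ≤ M := by
  have h' := abs_lt.1 h
  have h1 := abs_le.1 (hM (w + beta ρ))
  have h2 := abs_le.1 (hM (w - beta ρ))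
  rw [average, abs_le]
  constructor <;> nlinarith [h'.1, h'.2, h1.1, h1.2, h2.1, h2.2]

theorem hasDerivAt_average (ρ : ℝ) {φ φ' : ℝ → ℝ} (h : ∀ x, HasDerivAt φ (φ' x) x) (w : ℝ) :
    HasDerivAt (average ρ φ) (average ρ φ' w) w :=
  (((h (w + beta ρ)).comp_add_const w (beta ρ)).const_mul ((1 + ρ) / 2)).add
    (((h (w - beta ρ)).comp_sub_const w (beta ρ)).const_mul ((1 - ρ) / 2))

theorem hasDerivAt_one_sub_tanh_sq (x : ℝ) : HasDerivAt (fun x => 1 - Real.tanh x ^ 2)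
    (-2 * Real.tanh x * (1 - Real.tanh x ^ 2)) x := by
  refine (((hasDerivAt_tanh x).pow 2).const_sub 1).congr_deriv ?_
  push_cast; ring

theorem hasDerivAt_tanh_second (x : ℝ) :
    HasDerivAt (fun x => -2 * Real.tanh x * (1 - Real.tanh x ^ 2))
      ((6 * Real.tanh x ^ 2 - 2) * (1 - Real.tanh x ^ 2)) x := by
  refine (((hasDerivAt_tanh x).const_mul (-2)).mul (hasDerivAt_one_sub_tanh_sq x)).congr_deriv ?_
  ring

theorem abs_meanCoef_sub_le {ρ : ℝ} (h : |ρ| < 1) (m m' τ τ' : ℝ) :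
    |meanCoef ρ m τ - meanCoef ρ m' τ'| ≤ 4 * (|m - m'| + |τ ^ 2 - τ' ^ 2|) := by
  refine abs_integral_affine_sub_le (hasDerivAt_response ρ)
    (hasDerivAt_average ρ hasDerivAt_one_sub_tanh_sq) (abs_response_le h)
    (fun x => (abs_responseDeriv_le h x).trans (by norm_num)) (fun x => ?_) m m' τ τ'
  refine abs_average_le h (fun y => ?_) x
  have h1 := abs_lt.1 (Real.abs_tanh_lt_one y)
  have h2 := Real.tanh_sq_lt_one y
  rw [abs_le]; constructor <;> nlinarith [sq_nonneg (Real.tanh y)]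

theorem abs_selfCoef_sub_le {ρ : ℝ} (h : |ρ| < 1) (m m' τ τ' : ℝ) :
    |selfCoef ρ m τ - selfCoef ρ m' τ'| ≤ 4 * (|m - m'| + |τ ^ 2 - τ' ^ 2|) := by
  refine abs_integral_affine_sub_le (ψ := responseDeriv ρ)
    (hasDerivAt_average ρ hasDerivAt_one_sub_tanh_sq)
    (hasDerivAt_average ρ hasDerivAt_tanh_second) (abs_responseDeriv_le h)
    (abs_average_le h fun y => ?_) (abs_average_le h fun y => ?_) m m' τ τ'
  · have h1 := abs_lt.1 (Real.abs_tanh_lt_one y)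
    have h2 := Real.tanh_sq_lt_one y
    rw [abs_le]; constructor <;> nlinarith [sq_nonneg (Real.tanh y)]
  · have h2 := Real.tanh_sq_lt_one y
    rw [abs_le]; constructor <;> nlinarith [sq_nonneg (Real.tanh y)]

/-! ### The self coefficient is a contraction factor -/

theorem selfCoef_nonneg {ρ : ℝ} (h : |ρ| < 1) (m τ : ℝ) : 0 ≤ selfCoef ρ m τ :=
  integral_nonneg fun _ => responseDeriv_nonneg h _

/-- The rate constant of the contraction by the self coefficient. -/
def shrinkRate (Cρ R : ℝ) : ℝ := (1 - Cρ) / 4 * bandMass / Real.cosh R ^ 2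

theorem shrinkRate_pos {Cρ : ℝ} (h : Cρ < 1) (R : ℝ) : 0 < shrinkRate Cρ R := by
  have := bandMass_pos
  have := Real.cosh_pos R
  have : 0 < 1 - Cρ := by linarith
  unfold shrinkRate
  positivity

theorem selfCoef_le {ρ Cρ R τ : ℝ} (h0 : 0 ≤ ρ) (hρ : ρ ≤ Cρ) (hC : Cρ < 1) (hτ0 : 0 ≤ τ)
    (hτ : τ ≤ R) (m : ℝ) : selfCoef ρ m τ ≤ 1 - shrinkRate Cρ R * (ρ ^ 2 + τ ^ 2) := by
  have h : |ρ| < 1 := abs_lt.2 ⟨by linarith, by linarith⟩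
  have hi := integrable_comp_affine (continuous_responseDeriv ρ) (abs_responseDeriv_le h) m τ
  set ψ : ℝ → ℝ := fun z => 1 - responseDeriv ρ (m + τ * z) with hψ
  have hψi : Integrable ψ stdNormal := (integrable_const 1).sub hi
  have hψ0 : ∀ z, 0 ≤ ψ z := fun z => sub_nonneg.2 (responseDeriv_le_one h _)
  have hint : ∫ z, ψ z ∂stdNormal = 1 - selfCoef ρ m τ := by
    rw [hψ, integral_sub (integrable_const 1) hi]; simp [selfCoef]
  have hβ := beta_nonneg h0 (by linarith : ρ < 1)
  have hψe : ∀ z, ψ z = (1 + ρ) / 2 * Real.tanh (m + τ * z + beta ρ) ^ 2 +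
      (1 - ρ) / 2 * Real.tanh (m + τ * z - beta ρ) ^ 2 := by
    intro z; simp only [hψ, responseDeriv_eq_one_sub]; ring
  set t := Real.tanh (τ + beta ρ) with ht
  have hcosh := Real.one_le_cosh R
  have ht1 : τ / Real.cosh R ≤ t :=
    (div_cosh_le_tanh hτ0 hτ).trans (tanh_mono (by linarith))
  have ht2 : ρ ≤ t := by
    calc ρ = Real.tanh (beta ρ) := (tanh_beta h).symm
      _ ≤ t := tanh_mono (by linarith)
  -- One component suffices. For `m ≥ 0` and `z ∈ [1, 2]` the argument `m + τ z + β` exceeds `τ +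
  -- β`; for `m ≤ 0` the reflected band and the other component do the same. The factor `(1 - Cρ)/2`
  -- bounds either weight below.
  have hband : (1 - Cρ) / 2 * t ^ 2 * bandMass ≤ ∫ z, ψ z ∂stdNormal := by
    have ht0 : 0 ≤ t := h0.trans ht2
    rcases le_total 0 m with hm | hm
    · refine bandMass_le_integral hψi hψ0 fun z hz1 _ => ?_
      have h1 : t ≤ Real.tanh (m + τ * z + beta ρ) := tanh_mono (by nlinarith)
      have h2 : t ^ 2 ≤ Real.tanh (m + τ * z + beta ρ) ^ 2 := by gcongr
      rw [hψe]
      have h3 : 0 ≤ (1 - ρ) / 2 * Real.tanh (m + τ * z - beta ρ) ^ 2 :=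
        mul_nonneg (by linarith) (sq_nonneg _)
      nlinarith [sq_nonneg t]
    · rw [← integral_neg_stdNormal]
      refine bandMass_le_integral (integrable_neg_stdNormal hψi) (fun z => hψ0 (-z))
        fun z hz1 _ => ?_
      have h1 : t ≤ Real.tanh (-(m + τ * -z - beta ρ)) := tanh_mono (by nlinarith)
      rw [Real.tanh_neg] at h1
      have h2 : t ^ 2 ≤ Real.tanh (m + τ * -z - beta ρ) ^ 2 := by nlinarith
      rw [hψe]
      have h3 : 0 ≤ (1 + ρ) / 2 * Real.tanh (m + τ * -z + beta ρ) ^ 2 :=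
        mul_nonneg (by linarith) (sq_nonneg _)
      nlinarith [sq_nonneg t]
  have hsq : (ρ ^ 2 + τ ^ 2) / Real.cosh R ^ 2 ≤ 2 * t ^ 2 := by
    have h1 : (τ / Real.cosh R) ^ 2 ≤ t ^ 2 := by gcongr
    have h2 : ρ ^ 2 ≤ t ^ 2 := by gcongr
    have h3 : ρ ^ 2 / Real.cosh R ^ 2 ≤ ρ ^ 2 := div_le_self (sq_nonneg _) (by nlinarith)
    rw [div_pow] at h1
    rw [add_div]; linarith
  have hfin : shrinkRate Cρ R * (ρ ^ 2 + τ ^ 2) ≤ (1 - Cρ) / 2 * t ^ 2 * bandMass := by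
    have hb := bandMass_pos
    have : 0 ≤ (1 - Cρ) / 4 * bandMass := mul_nonneg (by linarith) hb.le
    calc shrinkRate Cρ R * (ρ ^ 2 + τ ^ 2) =
        (1 - Cρ) / 4 * bandMass * ((ρ ^ 2 + τ ^ 2) / Real.cosh R ^ 2) := by unfold shrinkRate; ring
      _ ≤ (1 - Cρ) / 4 * bandMass * (2 * t ^ 2) := by gcongr
      _ = _ := by ring
  linarith

/-! ### Reduction of the population map to one dimension -/

variable {d : ℕ}

theorem stdGaussian_map_inner (θ : EuclideanSpace ℝ (Fin d)) :
    (stdGaussian (EuclideanSpace ℝ (Fin d))).map (fun z => inner ℝ θ z) =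
      stdNormal.map (fun x => ‖θ‖ * x) := by
  have h := IsGaussian.map_eq_gaussianReal (μ := stdGaussian (EuclideanSpace ℝ (Fin d)))
    (innerSL ℝ θ)
  rw [integral_strongDual_stdGaussian, variance_dual_stdGaussian, innerSL_apply_norm] at h
  rw [gaussianReal_map_const_mul, mul_zero, mul_one]
  refine Eq.trans h ?_
  congr 1
  ext
  simp

theorem integral_comp_inner {ψ : ℝ → ℝ} (hψ : Continuous ψ) (θ : EuclideanSpace ℝ (Fin d)) :
    ∫ z, ψ (inner ℝ θ z) ∂(stdGaussian (EuclideanSpace ℝ (Fin d))) =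
      ∫ x, ψ (‖θ‖ * x) ∂stdNormal := by
  rw [← integral_map (φ := fun x => ‖θ‖ * x) (f := ψ) (by fun_prop) hψ.aestronglyMeasurable,
    ← stdGaussian_map_inner,
    integral_map (φ := fun z => inner ℝ θ z) (f := ψ) (by fun_prop) hψ.aestronglyMeasurable]

theorem integrable_smul_self {c : EuclideanSpace ℝ (Fin d) → ℝ} (hc : Continuous c) {K : ℝ}
    (h : ∀ z, |c z| ≤ K) :
    Integrable (fun z => c z • z) (stdGaussian (EuclideanSpace ℝ (Fin d))) :=
  IsGaussian.integrable_id.bdd_smul K hc.aestronglyMeasurable (ae_of_all _ h)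

theorem integrable_bounded_smul_const {c : EuclideanSpace ℝ (Fin d) → ℝ} (hc : Continuous c) {K : ℝ}
    (h : ∀ z, |c z| ≤ K) (v : EuclideanSpace ℝ (Fin d)) :
    Integrable (fun z => c z • v) (stdGaussian (EuclideanSpace ℝ (Fin d))) :=
  ((integrable_const K).mono' hc.aestronglyMeasurable (ae_of_all _ h)).smul_const v

/-- Stein's identity for the response in several dimensions. -/
theorem integral_response_smul_self {ρ : ℝ} (h : |ρ| < 1) (m : ℝ)
    (θ : EuclideanSpace ℝ (Fin d)) :
    ∫ z, response ρ (m + inner ℝ θ z) • z ∂(stdGaussian (EuclideanSpace ℝ (Fin d))) =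
      selfCoef ρ m ‖θ‖ • θ := by
  have hc := continuous_response ρ
  have hi : Integrable (fun z => response ρ (m + inner ℝ θ z) • z)
      (stdGaussian (EuclideanSpace ℝ (Fin d))) :=
    integrable_smul_self (by fun_prop) (fun z => abs_response_le h _)
  set V := ∫ z, response ρ (m + inner ℝ θ z) • z ∂(stdGaussian (EuclideanSpace ℝ (Fin d))) with hV
  -- Reflection in the line of `θ` preserves both the Gaussian law and `⟨θ, z⟩`, hence fixes `V` and
  -- puts it on that line. The coefficient follows by pairing with `θ`.
  set R := (ℝ ∙ θ).reflection with hR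
  have hRθ : R θ = θ :=
    (Submodule.reflection_eq_self_iff θ).2 (Submodule.mem_span_singleton_self θ)
  have hfix : R V = V := by
    have h1 : V = ∫ z, response ρ (m + inner ℝ θ z) • z
        ∂((stdGaussian (EuclideanSpace ℝ (Fin d))).map R) := by rw [stdGaussian_map, hV]
    rw [integral_map (by fun_prop) (Continuous.aestronglyMeasurable (by fun_prop))] at h1
    have h2 : ∀ z, inner ℝ θ (R z) = inner ℝ θ z := by
      intro z
      conv_lhs => rw [← hRθ]
      exact R.inner_map_map θ z
    simp only [h2, ← map_smul] at h1
    exact (h1.trans (R.toContinuousLinearEquiv.integral_comp_comm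
      (fun z => response ρ (m + inner ℝ θ z) • z))).symm
  obtain ⟨c, hcV⟩ := Submodule.mem_span_singleton.1 ((Submodule.reflection_eq_self_iff V).1 hfix)
  by_cases hθ : θ = 0
  · rw [← hcV, hθ]; simp
  have h3 : inner ℝ θ V = ‖θ‖ ^ 2 * selfCoef ρ m ‖θ‖ := by
    rw [hV, ← integral_inner hi]
    simp only [inner_smul_right]
    rw [integral_comp_inner (ψ := fun w => response ρ (m + w) * w) (by fun_prop)]
    have e : ∀ x : ℝ, response ρ (m + ‖θ‖ * x) * (‖θ‖ * x) =
        ‖θ‖ * (x * response ρ (m + ‖θ‖ * x)) := fun x => by ring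
    simp only [e]
    rw [integral_const_mul, integral_mul_response h]
    ring
  rw [← hcV, inner_smul_right, real_inner_self_eq_norm_sq] at h3
  have h4 : ‖θ‖ ^ 2 ≠ 0 := pow_ne_zero 2 (norm_ne_zero_iff.2 hθ)
  have h5 : c = selfCoef ρ m ‖θ‖ := mul_right_cancel₀ h4 (by linarith)
  rw [← hcV, h5]

theorem integral_neg_stdGaussian {F : EuclideanSpace ℝ (Fin d) → EuclideanSpace ℝ (Fin d)}
    (hF : Continuous F) :
    ∫ z, F (-z) ∂(stdGaussian (EuclideanSpace ℝ (Fin d))) =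
      ∫ z, F z ∂(stdGaussian (EuclideanSpace ℝ (Fin d))) := by
  have h1 : ∫ z, F z ∂(stdGaussian (EuclideanSpace ℝ (Fin d))) =
      ∫ z, F z ∂((stdGaussian (EuclideanSpace ℝ (Fin d))).map (LinearIsometryEquiv.neg ℝ)) := by
    rw [stdGaussian_map]
  rw [h1, integral_map (by fun_prop) hF.aestronglyMeasurable]
  simp

/-- The population map is a combination of the true and the current parameter. -/
theorem popMean_eq {ρ : ℝ} (h : |ρ| < 1) (θs θ : EuclideanSpace ℝ (Fin d)) :
    popMean θs ρ θ ρ = meanCoef ρ (inner ℝ θ θs) ‖θ‖ • θs +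
      selfCoef ρ (inner ℝ θ θs) ‖θ‖ • θ := by
  have h' := abs_lt.1 h
  have ht := continuous_tanh
  have hr := continuous_response ρ
  have hb : ∀ x, |Real.tanh x| ≤ 1 := fun x => (Real.abs_tanh_lt_one x).le
  set μ := stdGaussian (EuclideanSpace ℝ (Fin d)) with hμ
  have hem : Continuous (emTerm θ ρ) := by unfold emTerm; fun_prop
  have hi : ∀ v : EuclideanSpace ℝ (Fin d), Integrable (fun z => emTerm θ ρ (v + z)) μ := by
    intro v
    have e : (fun z => emTerm θ ρ (v + z)) = fun z =>
        Real.tanh (inner ℝ θ (v + z) + beta ρ) • v + Real.tanh (inner ℝ θ (v + z) + beta ρ) • z := by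
      funext z; rw [emTerm, smul_add]
    rw [e]
    exact (integrable_bounded_smul_const (by fun_prop) (fun z => hb _) v).add
      (integrable_smul_self (by fun_prop) (fun z => hb _))
  have him : ∀ v : EuclideanSpace ℝ (Fin d), Integrable (emTerm θ ρ) (μ.map (fun z => v + z)) :=
    fun v => (integrable_map_measure hem.aestronglyMeasurable (by fun_prop)).2 (hi v)
  have e1 : popMean θs ρ θ ρ = ((1 + ρ) / 2) • (∫ z, emTerm θ ρ (θs + z) ∂μ) +
      ((1 - ρ) / 2) • (∫ z, emTerm θ ρ (-θs + z) ∂μ) := by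
    rw [popMean, mixture, integral_add_measure ((him θs).smul_measure ENNReal.ofReal_ne_top)
      ((him (-θs)).smul_measure ENNReal.ofReal_ne_top), integral_smul_measure,
      integral_smul_measure, integral_map (by fun_prop) hem.aestronglyMeasurable,
      integral_map (by fun_prop) hem.aestronglyMeasurable,
      ENNReal.toReal_ofReal (by linarith), ENNReal.toReal_ofReal (by linarith)]
  have e2 : ∫ z, emTerm θ ρ (-θs + z) ∂μ =
      ∫ z, Real.tanh (inner ℝ θ (θs + z) - beta ρ) • (θs + z) ∂μ := by
    rw [← integral_neg_stdGaussian (F := fun z => emTerm θ ρ (-θs + z)) (by fun_prop)]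
    refine integral_congr_ae (ae_of_all _ fun z => ?_)
    simp only [emTerm]
    rw [show -θs + -z = -(θs + z) by abel, inner_neg_right, smul_neg, ← neg_smul, ← Real.tanh_neg]
    congr 2
    ring
  have hi2 : Integrable (fun z => Real.tanh (inner ℝ θ (θs + z) - beta ρ) • (θs + z)) μ := by
    simp only [smul_add]
    exact (integrable_bounded_smul_const (by fun_prop) (fun z => hb _) θs).add
      (integrable_smul_self (by fun_prop) (fun z => hb _))
  have e3 : popMean θs ρ θ ρ = ∫ z, (response ρ (inner ℝ θ θs + inner ℝ θ z) • θs +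
      response ρ (inner ℝ θ θs + inner ℝ θ z) • z) ∂μ := by
    rw [e1, e2, ← integral_smul, ← integral_smul,
      ← integral_add (f := fun z => ((1 + ρ) / 2) • emTerm θ ρ (θs + z))
        (g := fun z => ((1 - ρ) / 2) • Real.tanh (inner ℝ θ (θs + z) - beta ρ) • (θs + z))
        ((hi θs).smul ((1 + ρ) / 2)) (hi2.smul ((1 - ρ) / 2))]
    refine integral_congr_ae (ae_of_all _ fun z => ?_)
    simp only [emTerm, response, inner_add_right]
    rw [smul_smul, smul_smul, ← add_smul, ← smul_add]
  rw [e3, integral_add (integrable_bounded_smul_const (by fun_prop) (fun z => abs_response_le h _) θs)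
    (integrable_smul_self (by fun_prop) (fun z => abs_response_le h _)),
    integral_response_smul_self h, integral_smul_const,
    integral_comp_inner (ψ := fun w => response ρ (inner ℝ θ θs + w)) (by fun_prop), meanCoef]

/-! ### Scalar recursions -/

theorem one_sub_pow_le_exp {q : ℝ} (hq : q ≤ 1) (j : ℕ) : (1 - q) ^ j ≤ Real.exp (-(q * j)) := by
  have h1 : 1 - q ≤ Real.exp (-q) := by linarith [Real.add_one_le_exp (-q)]
  calc (1 - q) ^ j ≤ Real.exp (-q) ^ j := by gcongr
    _ = Real.exp (-(q * j)) := by rw [← Real.exp_nat_mul]; ring_nf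

theorem affine_recursion_le {e : ℕ → ℝ} {q δ : ℝ} (hq0 : 0 < q) (hq : q ≤ 1) (hδ : 0 ≤ δ)
    (h : ∀ t, e (t + 1) ≤ (1 - q) * e t + δ) (t : ℕ) :
    e t ≤ (1 - q) ^ t * e 0 + δ / q := by
  induction t with
  | zero => simp; positivity
  | succ t ih =>
    calc e (t + 1) ≤ (1 - q) * e t + δ := h t
      _ ≤ (1 - q) * ((1 - q) ^ t * e 0 + δ / q) + δ := by
          have : 0 ≤ 1 - q := by linarith
          gcongr
      _ = (1 - q) ^ (t + 1) * e 0 + δ / q := by field_simp; ring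

theorem exp_half_le_one_add {q : ℝ} (hq0 : 0 ≤ q) (hq : q ≤ 1) : Real.exp (q / 2) ≤ 1 + q := by
  have h1 : 1 - q / 2 ≤ Real.exp (-(q / 2)) := by linarith [Real.add_one_le_exp (-(q / 2))]
  have h2 : Real.exp (q / 2) * Real.exp (-(q / 2)) = 1 := by rw [← Real.exp_add]; simp
  have h3 := Real.exp_pos (q / 2)
  have h4 : Real.exp (q / 2) * (1 - q / 2) ≤ 1 := by
    calc Real.exp (q / 2) * (1 - q / 2) ≤ Real.exp (q / 2) * Real.exp (-(q / 2)) := by gcongr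
      _ = 1 := h2
  have h5 : 1 ≤ (1 + q) * (1 - q / 2) := by nlinarith
  exact le_of_mul_le_mul_right (h4.trans h5) (by linarith)

/-! ### Large signals: the coupled recursion for the signal and orthogonal components. -/

/-- The noise amplification constant for large signals. -/
def noiseConst (k C₄ : ℝ) : ℝ := 12 / k ^ 2 + 2 + 2 / C₄

/-- The hypotheses on the scale of the parameters for large signals. -/
structure LargeSignal (k C₄ ε η ρ ω : ℝ) : Prop where
  k_pos : 0 < k
  k_le : k ≤ 1
  C₄_pos : 0 < C₄
  C₄_le : C₄ ≤ 1
  ε_pos : 0 < ε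
  ε_le : ε ≤ k
  ε_small : noiseConst k C₄ * ε ≤ k * C₄ ^ 2 / 4
  ρ_pos : 0 < ρ
  ρ_lt : ρ < 1
  ω_pos : 0 < ω
  ω_le : ω ≤ ε * ρ ^ 2
  η_large : C₄ * ρ ≤ η
  rate_le : k * η ^ 2 ≤ 1

/-- The properties of the one-dimensional population map that drive the iteration. -/
structure SignalDrift (F : ℝ → ℝ) (k η ρ : ℝ) : Prop where
  mono : Monotone F
  fixed : F η = η
  ascent : ∀ α, 0 ≤ α → α ≤ η → k * (ρ ^ 2 + α * η) * (η - α) ≤ F α - α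
  descent : ∀ α, η ≤ α → F α - η ≤ (1 - k * η ^ 2) * (α - η)

/-- One step of the iteration in terms of the signal component `α`, the size `b` of the orthogonal
component, and the norm `τ`. -/
structure PerturbedStep (F : ℝ → ℝ) (k η ρ ω α b τ α' b' : ℝ) : Prop where
  τ_nonneg : 0 ≤ τ
  τ_sq : τ ^ 2 = α ^ 2 + b ^ 2
  signal : |α' - F α| ≤ 4 * b ^ 2 * (η + |α|) + max τ ρ * ω
  orthogonal : ∃ B, 0 ≤ B ∧ B ≤ 1 - k * (ρ ^ 2 + τ ^ 2) ∧ b' ≤ B * b + max τ ρ * ω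

/-- The region in which the iteration stays. -/
structure Invariant (k η ρ ω α b : ℝ) : Prop where
  α_nonneg : 0 ≤ α
  α_le : α ≤ 2 * η
  b_nonneg : 0 ≤ b
  b_le : b ≤ ω / (k * ρ)

section

variable {F : ℝ → ℝ} {k C₄ ε η ρ ω α b τ α' b' : ℝ}

theorem LargeSignal.η_pos (h : LargeSignal k C₄ ε η ρ ω) : 0 < η :=
  (mul_pos h.C₄_pos h.ρ_pos).trans_le h.η_large

theorem LargeSignal.ρ_le (h : LargeSignal k C₄ ε η ρ ω) : ρ ≤ η / C₄ := by
  rw [le_div_iff₀ h.C₄_pos, mul_comm]; exact h.η_large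

theorem LargeSignal.noiseConst_pos (h : LargeSignal k C₄ ε η ρ ω) : 0 < noiseConst k C₄ := by
  have := h.k_pos
  have := h.C₄_pos
  unfold noiseConst; positivity

theorem Invariant.b_le_ρ (h : LargeSignal k C₄ ε η ρ ω) (hi : Invariant k η ρ ω α b) : b ≤ ρ := by
  refine hi.b_le.trans ?_
  rw [div_le_iff₀ (mul_pos h.k_pos h.ρ_pos)]
  nlinarith [h.ω_le, mul_le_mul_of_nonneg_right h.ε_le (sq_nonneg ρ)]

/-- The quadratic leakage is no worse than the sampling noise: `b² ≤ ω²/(k²ρ²) ≤ ω/k²`, since `ω ≤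
ρ²`. -/
theorem Invariant.noise_le (h : LargeSignal k C₄ ε η ρ ω) (hi : Invariant k η ρ ω α b)
    (hs : PerturbedStep F k η ρ ω α b τ α' b') :
    4 * b ^ 2 * (η + |α|) + max τ ρ * ω ≤ noiseConst k C₄ * η * ω ∧
      max τ ρ * ω ≤ noiseConst k C₄ * η * ω := by
  have hη := h.η_pos
  have hk := h.k_pos
  have hρ := h.ρ_pos
  have hω := h.ω_pos
  have hC := h.C₄_pos
  have hb := hi.b_nonneg
  have hα := hi.α_nonneg
  have hbρ := hi.b_le_ρ h
  have hτ : τ ≤ α + b := by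
    refine le_of_sq_le_sq ?_ (by linarith)
    rw [hs.τ_sq]; nlinarith
  have hmax : max τ ρ ≤ (2 + 2 / C₄) * η := by
    have h1 := h.ρ_le
    have h2 : (2 + 2 / C₄) * η = 2 * η + 2 * (η / C₄) := by ring
    rw [h2]
    refine max_le ?_ ?_ <;> linarith [hi.α_le]
  have hb2 : b ^ 2 ≤ ω / k ^ 2 := by
    have h1 : ω ≤ 1 * ρ ^ 2 := h.ω_le.trans (by gcongr; exact h.ε_le.trans h.k_le)
    calc b ^ 2 ≤ (ω / (k * ρ)) ^ 2 := by gcongr; exact hi.b_le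
      _ = ω / k ^ 2 * (ω / ρ ^ 2) := by field_simp
      _ ≤ ω / k ^ 2 * 1 := by
          gcongr
          rw [div_le_one (by positivity)]; linarith
      _ = _ := mul_one _
  have h1 : 4 * b ^ 2 * (η + |α|) ≤ 12 / k ^ 2 * η * ω := by
    rw [abs_of_nonneg hα]
    calc 4 * b ^ 2 * (η + α) ≤ 4 * (ω / k ^ 2) * (η + 2 * η) := by gcongr; exact hi.α_le
      _ = _ := by ring
  have h2 : max τ ρ * ω ≤ (2 + 2 / C₄) * η * ω := by gcongr
  have h3 : 0 ≤ 12 / k ^ 2 * η * ω := by positivity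
  have e : noiseConst k C₄ * η * ω = 12 / k ^ 2 * η * ω + (2 + 2 / C₄) * η * ω := by
    unfold noiseConst; ring
  rw [e]
  exact ⟨by linarith, by linarith⟩

/-- Compares the noise with the two sources of drift: the kick of order `ηρ²` near `α = 0` and the
pull of order `η³` at scale `α ≈ η`. -/
theorem LargeSignal.noise_small (h : LargeSignal k C₄ ε η ρ ω) :
    noiseConst k C₄ * η * ω ≤ k / 4 * η * ρ ^ 2 ∧ noiseConst k C₄ * η * ω ≤ k / 4 * η ^ 3 := by
  have hη := h.η_pos
  have hk := h.k_pos
  have hN := h.noiseConst_pos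
  have hC := h.C₄_pos
  have hρ := h.ρ_pos
  have h1 : noiseConst k C₄ * η * ω ≤ k / 4 * η * (C₄ * ρ) ^ 2 := by
    calc noiseConst k C₄ * η * ω ≤ noiseConst k C₄ * η * (ε * ρ ^ 2) := by gcongr; exact h.ω_le
      _ = noiseConst k C₄ * ε * (η * ρ ^ 2) := by ring
      _ ≤ k * C₄ ^ 2 / 4 * (η * ρ ^ 2) := by gcongr; exact h.ε_small
      _ = _ := by ring
  constructor
  · refine h1.trans ?_
    gcongr
    exact mul_le_of_le_one_left hρ.le h.C₄_le
  · refine h1.trans ?_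
    rw [show k / 4 * η ^ 3 = k / 4 * η * η ^ 2 by ring]
    gcongr
    exact h.η_large

theorem Invariant.step (h : LargeSignal k C₄ ε η ρ ω) (hF : SignalDrift F k η ρ)
    (hi : Invariant k η ρ ω α b) (hs : PerturbedStep F k η ρ ω α b τ α' b') (hb' : 0 ≤ b') :
    Invariant k η ρ ω α' b' ∧
    (α ≤ η / 2 → (1 + k * η ^ 2 / 4) * α + k / 4 * η * ρ ^ 2 ≤ α') ∧
    (η / 2 ≤ α → η / 2 ≤ α' ∧ |α' - η| + b' ≤
      (1 - k * η ^ 2 / 4) * (|α - η| + b) + 2 * (noiseConst k C₄ * η * ω)) := by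
  have hη := h.η_pos
  have hk := h.k_pos
  have hρ := h.ρ_pos
  have hω := h.ω_pos
  have hα := hi.α_nonneg
  have hb := hi.b_nonneg
  obtain ⟨n1, n2⟩ := hi.noise_le h hs
  obtain ⟨s1, s2⟩ := h.noise_small
  set N := noiseConst k C₄ * η * ω
  have hsig := abs_le.1 (hs.signal.trans n1)
  obtain ⟨B, hB0, hB1, hB2⟩ := hs.orthogonal
  have hr := h.rate_le
  -- Here `η - α ≥ η/2`, so the drift is at least `kηρ²/2 + kη²α/2`; the noise consumes at most half
  -- of the first term.
  have early : α ≤ η / 2 → (1 + k * η ^ 2 / 4) * α + k / 4 * η * ρ ^ 2 ≤ α' := by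
    intro hα2
    have h1 := hF.ascent α hα (by linarith)
    have h2 : k * (ρ ^ 2 + α * η) * (η / 2) ≤ k * (ρ ^ 2 + α * η) * (η - α) := by
      gcongr; linarith
    have h3 : 0 ≤ k * (α * η) * η := by positivity
    nlinarith
  have late : η / 2 ≤ α → η / 2 ≤ α' := by
    intro hα2
    have h1 := hF.mono hα2
    have h2 := hF.ascent (η / 2) (by linarith) (by linarith)
    have h3 : 0 ≤ k * (η / 2 * η) * (η - η / 2) := by
      have : 0 ≤ η - η / 2 := by linarith
      positivity
    have h4 : 0 ≤ k * ρ ^ 2 * η := by positivity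
    nlinarith
  have upper : α' ≤ 2 * η := by
    rcases le_total α η with hle | hle
    · have h1 := hF.mono hle
      rw [hF.fixed] at h1
      have h2 : k / 4 * η * ρ ^ 2 ≤ η := by
        have : k / 4 * ρ ^ 2 ≤ 1 := by nlinarith [h.k_le, h.ρ_lt]
        nlinarith
      linarith
    · have h1 := hF.descent α hle
      have h2 : (1 - k * η ^ 2) * (α - η) ≤ (1 - k * η ^ 2) * η := by
        have : 0 ≤ 1 - k * η ^ 2 := by linarith
        gcongr
        linarith [hi.α_le]
      have h3 : 0 ≤ k * η ^ 3 := by positivity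
      nlinarith
  have hmaxsq : k * (max τ ρ) ^ 2 ≤ k * (ρ ^ 2 + τ ^ 2) := by
    gcongr
    rcases max_choice τ ρ with hm | hm <;> rw [hm] <;> nlinarith [sq_nonneg τ, sq_nonneg ρ]
  refine ⟨⟨?_, upper, hb', ?_⟩, early, fun hα2 => ⟨late hα2, ?_⟩⟩
  · rcases le_total α (η / 2) with hle | hle
    · exact le_trans (by positivity) (early hle)
    · exact le_trans (by positivity) (late hle)
  · have hm : ρ ≤ max τ ρ := le_max_right _ _
    have hm0 : 0 < max τ ρ := hρ.trans_le hm
    have h1 : B * b ≤ (1 - k * (max τ ρ) ^ 2) * (ω / (k * ρ)) := by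
      have : 0 ≤ 1 - k * (max τ ρ) ^ 2 := by linarith
      have h3 := hi.b_le
      have h4 : B ≤ 1 - k * (max τ ρ) ^ 2 := by linarith
      gcongr
    -- The value `ω/(kρ)` is a supersolution: with `m = max τ ρ`, contraction by `1 - k m²` removes
    -- `m² ω/ρ`, which is at least the noise `m ω` because `m ≥ ρ`.
    have h2 : max τ ρ * ω ≤ k * (max τ ρ) ^ 2 * (ω / (k * ρ)) := by
      have : k * (max τ ρ) ^ 2 * (ω / (k * ρ)) = max τ ρ * ω * (max τ ρ / ρ) := by field_simp
      rw [this]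
      exact le_mul_of_one_le_right (by positivity) ((one_le_div hρ).2 hm)
    linarith
  · have h1 : |F α - η| ≤ (1 - k * η ^ 2 / 4) * |α - η| := by
      rcases le_total α η with hle | hle
      · have e1 := hF.mono hle
        rw [hF.fixed] at e1
        have e2 := hF.ascent α hα hle
        rw [abs_of_nonpos (by linarith), abs_of_nonpos (by linarith)]
        have e3 : k * η ^ 2 / 4 * (η - α) ≤ k * (ρ ^ 2 + α * η) * (η - α) := by
          have e4 : η / 2 * η ≤ α * η := by gcongr
          have e5 : η ^ 2 / 4 ≤ ρ ^ 2 + α * η := by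
            linarith only [e4, sq_nonneg ρ, sq_nonneg η, (by ring : η / 2 * η = η ^ 2 / 2)]
          have : k * η ^ 2 / 4 ≤ k * (ρ ^ 2 + α * η) := by
            rw [mul_div_assoc]; gcongr
          have : 0 ≤ η - α := by linarith
          gcongr
        linarith only [e2, e3]
      · have e1 := hF.mono hle
        rw [hF.fixed] at e1
        have e2 := hF.descent α hle
        rw [abs_of_nonneg (by linarith), abs_of_nonneg (by linarith)]
        have e3 : 0 ≤ k * η ^ 2 * (α - η) := by
          have : 0 ≤ α - η := by linarith
          positivity
        linarith only [e2, e3]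
    have h2 : |α' - η| ≤ |F α - η| + N := by
      have := abs_sub_le α' (F α) η
      have := hs.signal
      linarith
    have h3 : B * b ≤ (1 - k * η ^ 2 / 4) * b := by
      have e1 : η ^ 2 / 4 ≤ τ ^ 2 := by
        have : (η / 2) ^ 2 ≤ α ^ 2 := by gcongr
        rw [hs.τ_sq]
        linarith only [this, sq_nonneg b, (by ring : (η / 2) ^ 2 = η ^ 2 / 4)]
      have e2 : B ≤ 1 - k * η ^ 2 / 4 := by
        have : k * (η ^ 2 / 4) ≤ k * (ρ ^ 2 + τ ^ 2) := by
          gcongr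
          linarith only [e1, sq_nonneg ρ]
        linarith only [this, hB1, mul_div_assoc k (η ^ 2) 4]
      gcongr
    linarith

end

/-- Convergence of a perturbed iteration in the large signal regime. -/
theorem large_signal_convergence {F : ℝ → ℝ} {k C₄ C₆ ε η ρ ω Cθ : ℝ} {α b τ : ℕ → ℝ}
    (h : LargeSignal k C₄ ε η ρ ω) (hF : SignalDrift F k η ρ) (hη : η ≤ Cθ)
    (hC₆ : 0 < C₆) (hC₆k : C₆ ≤ k / 2) (hC₆e : C₆ ≤ Real.exp (-1))
    (hb : ∀ t, 0 ≤ b t) (h0 : Invariant k η ρ ω (α 0) (b 0))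
    (hstep : ∀ t, Invariant k η ρ ω (α t) (b t) →
      PerturbedStep F k η ρ ω (α t) (b t) (τ t) (α (t + 1)) (b (t + 1)))
    (t : ℕ) (ht : (12 / k + 2 * Cθ ^ 2) * (1 / η ^ 2 * Real.log (1 / (C₆ * ρ * ω))) ≤ t) :
    |α t - η| + b t ≤ ((1 + 1 / C₄) * Cθ ^ 2 + 8 * noiseConst k C₄ / k) * (ω / η) := by
  have hη0 := h.η_pos
  have hk := h.k_pos
  have hρ := h.ρ_pos
  have hω := h.ω_pos
  have hN := h.noiseConst_pos
  have hC₄ := h.C₄_pos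
  have hω1 : ω ≤ ρ ^ 2 := by
    refine h.ω_le.trans (mul_le_of_le_one_left (sq_nonneg ρ) (h.ε_le.trans h.k_le))
  have hω2 : ω ≤ 1 := hω1.trans (by nlinarith [h.ρ_lt])
  have inv : ∀ t, Invariant k η ρ ω (α t) (b t) := by
    intro t
    induction t with
    | zero => exact h0
    | succ t ih => exact (ih.step h hF (hstep t ih) (hb _)).1
  have st := fun t => ((inv t).step h hF (hstep t (inv t)) (hb (t + 1))).2
  set q := k * η ^ 2 / 4 with hq
  have hq0 : 0 < q := by positivity
  have hq1 : q ≤ 1 := by have := h.rate_le; rw [hq]; linarith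
  set L := Real.log (1 / (C₆ * ρ * ω)) with hL
  have hpos : 0 < C₆ * ρ * ω := by positivity
  have hexpL : Real.exp L = 1 / (C₆ * ρ * ω) := Real.exp_log (by positivity)
  have hL1 : 1 ≤ L := by
    rw [hL, one_div, Real.log_inv, le_neg, Real.log_le_iff_le_exp hpos]
    calc C₆ * ρ * ω ≤ C₆ * 1 * 1 := by gcongr; exact h.ρ_lt.le
      _ ≤ _ := by rw [mul_one, mul_one]; exact hC₆e
  -- One step creates the seed `kηρ²/4` even from `α = 0`; the other `2L/q` amplify it by `e^L`, as
  -- `1 + q ≥ e^{q/2}`.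
  set t₁ := ⌈1 + 2 * L / q⌉₊ with ht₁
  have ht₁le : (t₁ : ℝ) ≤ 2 + 2 * L / q := by
    have := Nat.ceil_lt_add_one (by positivity : 0 ≤ 1 + 2 * L / q)
    rw [ht₁]; linarith
  have ht₁ge : 1 + 2 * L / q ≤ t₁ := Nat.le_ceil _
  have reach : η / 2 ≤ α t₁ := by
    by_contra hlt
    push Not at hlt
    -- Once `η/2` is crossed it stays crossed, so failure at `t₁` means that growth applied at every
    -- earlier time.
    have below : ∀ s, s ≤ t₁ → α s < η / 2 := by
      intro s hs
      by_contra hge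
      push Not at hge
      have up : ∀ r, s ≤ r → η / 2 ≤ α r := by
        intro r hr
        induction r, hr using Nat.le_induction with
        | base => exact hge
        | succ r _ ih => exact ((st r).2 ih).1
      linarith [up t₁ hs]
    have grow : ∀ s, s + 1 ≤ t₁ → (1 + q) ^ s * (k / 4 * η * ρ ^ 2) ≤ α (s + 1) := by
      intro s
      induction s with
      | zero =>
        intro hs
        have h1 := (st 0).1 (below 0 (by lia)).le
        have h2 := (inv 0).α_nonneg
        have h3 : 0 ≤ (1 + q) * α 0 := by positivity
        simp only [pow_zero, one_mul]
        linarith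
      | succ s ih =>
        intro hs
        have h1 := (st (s + 1)).1 (below (s + 1) (by lia)).le
        have h2 := ih (by lia)
        have h3 : 0 ≤ k / 4 * η * ρ ^ 2 := by positivity
        calc (1 + q) ^ (s + 1) * (k / 4 * η * ρ ^ 2)
            = (1 + q) * ((1 + q) ^ s * (k / 4 * η * ρ ^ 2)) := by ring
          _ ≤ (1 + q) * α (s + 1) := by gcongr
          _ ≤ _ := by linarith
    have ht₁pos : 1 ≤ t₁ := by
      have h1 : (1 : ℝ) ≤ t₁ := by
        have : 0 ≤ 2 * L / q := by positivity
        linarith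
      exact_mod_cast h1
    obtain ⟨s, hs⟩ : ∃ s, t₁ = s + 1 := ⟨t₁ - 1, by lia⟩
    have h1 := grow s (by lia)
    rw [← hs] at h1
    have hsL : 2 * L / q ≤ s := by
      have : (t₁ : ℝ) = s + 1 := by rw [hs]; push_cast; rfl
      linarith
    have h2 : Real.exp L ≤ (1 + q) ^ s := by
      calc Real.exp L ≤ Real.exp (s * (q / 2)) := by
            rw [Real.exp_le_exp]
            rw [div_le_iff₀ hq0] at hsL
            linarith
        _ = Real.exp (q / 2) ^ s := Real.exp_nat_mul _ _
        _ ≤ _ := by gcongr; exact exp_half_le_one_add hq0.le hq1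
    -- The amplification needed to bring the seed to `η/2`; this is the reason for `C₆ ≤ k/2`.
    have h3 : 2 / (k * ρ ^ 2) ≤ Real.exp L := by
      rw [hexpL, div_le_div_iff₀ (by positivity) hpos]
      have e1 : C₆ * ρ * ω ≤ k / 2 * 1 * ρ ^ 2 := by gcongr; exact h.ρ_lt.le
      linarith
    have h4 : 2 / (k * ρ ^ 2) * (k / 4 * η * ρ ^ 2) ≤ α t₁ := by
      refine le_trans ?_ h1
      have := h3.trans h2
      gcongr
    have h5 : 2 / (k * ρ ^ 2) * (k / 4 * η * ρ ^ 2) = η / 2 := by field_simp; ring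
    linarith
  have stay : ∀ j, η / 2 ≤ α (t₁ + j) := by
    intro j
    induction j with
    | zero => exact reach
    | succ j ih => exact ((st (t₁ + j)).2 ih).1
  have recursion := affine_recursion_le (e := fun j => |α (t₁ + j) - η| + b (t₁ + j)) hq0 hq1
    (by positivity : 0 ≤ 2 * (noiseConst k C₄ * η * ω))
    (fun j => ((st (t₁ + j)).2 (stay j)).2)
  -- The part `12/k` of the constant yields `3L/q`, and `2 Cθ²` pays for the additive `2`, since `η
  -- ≤ Cθ` and `L ≥ 1`. After `t₁` at least `L/q` steps remain for the contraction.
  have hthree : 2 + 3 * L / q ≤ t := by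
    refine le_trans ?_ ht
    have e1 : (12 / k + 2 * Cθ ^ 2) * (1 / η ^ 2 * L) = 3 * L / q + 2 * (Cθ ^ 2 / η ^ 2) * L := by
      rw [hq]; field_simp; ring
    have e2 : 1 ≤ Cθ ^ 2 / η ^ 2 := by rw [one_le_div (by positivity)]; gcongr
    rw [e1]
    nlinarith
  have ht₁t : t₁ ≤ t := by
    have : (t₁ : ℝ) ≤ t := by
      have e1 : 3 * L / q = 2 * L / q + L / q := by ring
      have e2 : 0 ≤ L / q := by positivity
      linarith
    exact_mod_cast this
  obtain ⟨j, rfl⟩ : ∃ j, t = t₁ + j := ⟨t - t₁, by lia⟩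
  have hj : L / q ≤ j := by
    push_cast at hthree
    have e1 : 3 * L / q = 2 * L / q + L / q := by ring
    linarith
  have hpow : (1 - q) ^ j ≤ ω := by
    calc (1 - q) ^ j ≤ Real.exp (-(q * j)) := one_sub_pow_le_exp hq1 j
      _ ≤ Real.exp (-L) := by
          rw [Real.exp_le_exp]
          rw [div_le_iff₀ hq0] at hj
          linarith
      _ = C₆ * ρ * ω := by rw [Real.exp_neg, hexpL, one_div, inv_inv]
      _ ≤ 1 * 1 * ω := by
          gcongr
          · linarith [h.k_le]
          · exact h.ρ_lt.le
      _ = ω := by ring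
  have hstart : |α t₁ - η| + b t₁ ≤ (1 + 1 / C₄) * η := by
    have e1 : |α t₁ - η| ≤ η := by
      rw [abs_le]; constructor <;> linarith [(inv t₁).α_le]
    have e2 := (inv t₁).b_le_ρ h
    have e3 := h.ρ_le
    have e4 : (1 + 1 / C₄) * η = η + η / C₄ := by ring
    linarith
  have hfin := recursion j
  simp only [add_zero] at hfin
  have h0' : 0 ≤ |α t₁ - η| + b t₁ := add_nonneg (abs_nonneg _) (hb _)
  calc |α (t₁ + j) - η| + b (t₁ + j)
      ≤ (1 - q) ^ j * (|α t₁ - η| + b t₁) + 2 * (noiseConst k C₄ * η * ω) / q := hfin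
    _ ≤ ω * ((1 + 1 / C₄) * η) + 2 * (noiseConst k C₄ * η * ω) / q := by gcongr
    _ = (1 + 1 / C₄) * η ^ 2 * (ω / η) + 8 * noiseConst k C₄ / k * (ω / η) := by
        rw [hq]; field_simp; ring
    _ ≤ (1 + 1 / C₄) * Cθ ^ 2 * (ω / η) + 8 * noiseConst k C₄ / k * (ω / η) := by gcongr
    _ = _ := by ring

/-! ### Small signals -/

theorem coef_sum_eq_one {ρ η : ℝ} (h : |ρ| < 1) (hη : η ≠ 0) :
    meanCoef ρ (η * η) η + selfCoef ρ (η * η) η = 1 := by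
  have h1 := signalMap_eq h η η
  rw [signalMap_self h, ← add_mul] at h1
  exact (mul_right_cancel₀ hη (by rw [one_mul]; exact h1)).symm

/-- With `f(θ) - θs = B (θ - θs) + (A + B - 1) θs`, the fixed point gives `A + B = 1` at `θ = θs`,
so the second term is of order `(2η + τ) η ‖θ - θs‖`. The factor `k/40` lets half of the contraction
in `B` absorb it. -/
theorem norm_popMean_sub_le {ρ k : ℝ} (h0 : 0 < ρ) (h : ρ < 1) (hk0 : 0 < k) (hk : k ≤ 1)
    (θs θ : EuclideanSpace ℝ (Fin d)) (hη : ‖θs‖ ≤ k / 40 * ρ)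
    (hB : selfCoef ρ (inner ℝ θ θs) ‖θ‖ ≤ 1 - k * (ρ ^ 2 + ‖θ‖ ^ 2)) :
    ‖popMean θs ρ θ ρ - θs‖ ≤ (1 - k / 2 * ρ ^ 2) * ‖θ - θs‖ := by
  have hρ : |ρ| < 1 := abs_lt.2 ⟨by linarith, h⟩
  set η := ‖θs‖ with hηdef
  set τ := ‖θ‖ with hτdef
  set A := meanCoef ρ (inner ℝ θ θs) τ with hA
  set B := selfCoef ρ (inner ℝ θ θs) τ with hBdef
  set e := ‖θ - θs‖ with he
  have hB0 : 0 ≤ B := selfCoef_nonneg hρ _ _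
  have hη0 : 0 ≤ η := norm_nonneg _
  have hτ0 : 0 ≤ τ := norm_nonneg _
  have he0 : 0 ≤ e := norm_nonneg _
  have hdecomp : popMean θs ρ θ ρ - θs = B • (θ - θs) + (A + B - 1) • θs := by
    rw [popMean_eq hρ]
    module
  have hcoef : |A + B - 1| * η ≤ 8 * (2 * η + τ) * e * η := by
    rcases hη0.eq_or_lt with h1 | h1
    · simp [← h1]
    · have hsum := coef_sum_eq_one hρ h1.ne'
      have hm : |inner ℝ θ θs - η * η| ≤ η * e := by
        have : inner ℝ θ θs - η * η = inner ℝ (θ - θs) θs := by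
          rw [inner_sub_left, real_inner_self_eq_norm_sq]; ring
        rw [this, mul_comm]
        exact abs_real_inner_le_norm _ _
      have ht : |τ ^ 2 - η ^ 2| ≤ (τ + η) * e := by
        have : τ ^ 2 - η ^ 2 = (τ + η) * (τ - η) := by ring
        rw [this, abs_mul, abs_of_nonneg (by positivity : 0 ≤ τ + η)]
        gcongr
        exact abs_norm_sub_norm_le _ _
      have h2 := abs_meanCoef_sub_le hρ (inner ℝ θ θs) (η * η) τ η
      have h3 := abs_selfCoef_sub_le hρ (inner ℝ θ θs) (η * η) τ η
      have h4 : A + B - 1 = (A - meanCoef ρ (η * η) η) + (B - selfCoef ρ (η * η) η) := by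
        linarith
      have h5 : |A + B - 1| ≤ 8 * (2 * η + τ) * e := by
        rw [h4]
        refine (abs_add_le _ _).trans ?_
        linarith
      gcongr
  have hfin : 8 * (2 * η + τ) * η ≤ k / 2 * (ρ ^ 2 + τ ^ 2) := by
    have h1 : 8 * (2 * η + τ) * η ≤ 8 * (2 * ρ + τ) * (k / 40 * ρ) := by
      have : k / 40 * ρ ≤ ρ := by nlinarith
      gcongr
      linarith
    have h2 : 8 * (2 * ρ + τ) * (k / 40 * ρ) = k * ((2 * ρ ^ 2 + τ * ρ) / 5) := by ring
    have h3 : (2 * ρ ^ 2 + τ * ρ) / 5 ≤ (ρ ^ 2 + τ ^ 2) / 2 := by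
      nlinarith [sq_nonneg (ρ - τ), sq_nonneg ρ, sq_nonneg τ]
    have h4 := mul_le_mul_of_nonneg_left h3 hk0.le
    linarith
  have hτ2 : 0 ≤ k / 2 * τ ^ 2 := by positivity
  rw [hdecomp]
  calc ‖B • (θ - θs) + (A + B - 1) • θs‖ ≤ B * e + |A + B - 1| * η := by
        refine (norm_add_le _ _).trans ?_
        rw [norm_smul, norm_smul, Real.norm_eq_abs, Real.norm_eq_abs, abs_of_nonneg hB0]
    _ ≤ (1 - k * (ρ ^ 2 + τ ^ 2)) * e + (8 * (2 * η + τ) * η) * e := by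
        have := mul_le_mul_of_nonneg_right hB he0
        linarith
    _ ≤ (1 - k * (ρ ^ 2 + τ ^ 2)) * e + (k / 2 * (ρ ^ 2 + τ ^ 2)) * e := by gcongr
    _ ≤ (1 - k / 2 * ρ ^ 2) * e := by nlinarith

/-- The bound `e t ≤ ρ` is preserved, and `ω ≤ kρ²/8` lets the contraction absorb the noise
proportional to `e t`, so only `2ρω` accumulates. -/
theorem small_signal_recursion {e : ℕ → ℝ} {k ρ ω : ℝ} (hk0 : 0 < k) (hk : k ≤ 1) (h0 : 0 < ρ)
    (h1 : ρ < 1) (hω0 : 0 ≤ ω) (hω : ω ≤ k / 8 * ρ ^ 2) (he : ∀ t, 0 ≤ e t) (he0 : e 0 ≤ ρ)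
    (hstep : ∀ t, e t ≤ ρ → e (t + 1) ≤ (1 - k / 2 * ρ ^ 2) * e t + (e t + 2 * ρ) * ω) (t : ℕ) :
    e t ≤ Real.exp (-(k * ρ ^ 2 / 4 * t)) * e 0 + 8 / k * (ω / ρ) := by
  have step' : ∀ t, e t ≤ ρ → e (t + 1) ≤ (1 - k * ρ ^ 2 / 4) * e t + 2 * ρ * ω := by
    intro t ht
    have h2 := hstep t ht
    have h3 : e t * ω ≤ e t * (k / 8 * ρ ^ 2) := by gcongr; exact he t
    have h4 : 0 ≤ e t * (k * ρ ^ 2) := mul_nonneg (he t) (by positivity)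
    linarith
  have bound : ∀ t, e t ≤ ρ := by
    intro t
    induction t with
    | zero => exact he0
    | succ t ih =>
      have h2 := step' t ih
      have h3 : (1 - k * ρ ^ 2 / 4) * e t ≤ (1 - k * ρ ^ 2 / 4) * ρ := by
        have : 0 ≤ 1 - k * ρ ^ 2 / 4 := by nlinarith
        gcongr
      have h4 : 2 * ρ * ω ≤ 2 * ρ * (k / 8 * ρ ^ 2) := by gcongr
      linarith
  have hq1 : k * ρ ^ 2 / 4 ≤ 1 := by nlinarith
  have h2 := affine_recursion_le (by positivity) hq1 (by positivity : 0 ≤ 2 * ρ * ω)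
    (fun t => step' t (bound t)) t
  have h3 := mul_le_mul_of_nonneg_right (one_sub_pow_le_exp hq1 t) (he 0)
  have h4 : 2 * ρ * ω / (k * ρ ^ 2 / 4) = 8 / k * (ω / ρ) := by field_simp; ring
  linarith

/-! ### Signal and orthogonal components -/

/-- The component of `θ` along `θs`. -/
def signalPart (θs θ : EuclideanSpace ℝ (Fin d)) : ℝ := inner ℝ θ θs / ‖θs‖

/-- The component of `θ` orthogonal to `θs`. -/
def orthPart (θs θ : EuclideanSpace ℝ (Fin d)) : EuclideanSpace ℝ (Fin d) :=
  θ - (signalPart θs θ / ‖θs‖) • θs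

section

variable {θs : EuclideanSpace ℝ (Fin d)}

theorem norm_sq_eq_parts (hs : θs ≠ 0) (θ : EuclideanSpace ℝ (Fin d)) :
    ‖θ‖ ^ 2 = signalPart θs θ ^ 2 + ‖orthPart θs θ‖ ^ 2 := by
  have hη : ‖θs‖ ≠ 0 := norm_ne_zero_iff.2 hs
  rw [orthPart, @norm_sub_sq_real, norm_smul, inner_smul_right, Real.norm_eq_abs, mul_pow, sq_abs]
  have : inner ℝ θ θs = signalPart θs θ * ‖θs‖ := by rw [signalPart]; field_simp
  rw [this]
  field_simp
  ring

theorem abs_signalPart_le (hs : θs ≠ 0) (θ : EuclideanSpace ℝ (Fin d)) :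
    |signalPart θs θ| ≤ ‖θ‖ :=
  abs_le_of_sq_le_sq (by rw [norm_sq_eq_parts hs θ]; linarith [sq_nonneg ‖orthPart θs θ‖])
    (norm_nonneg θ)

theorem norm_orthPart_le (hs : θs ≠ 0) (θ : EuclideanSpace ℝ (Fin d)) : ‖orthPart θs θ‖ ≤ ‖θ‖ :=
  le_of_sq_le_sq (by rw [norm_sq_eq_parts hs θ]; linarith [sq_nonneg (signalPart θs θ)])
    (norm_nonneg θ)

theorem signalPart_sub (θ θ' : EuclideanSpace ℝ (Fin d)) :
    signalPart θs (θ - θ') = signalPart θs θ - signalPart θs θ' := by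
  simp only [signalPart, inner_sub_left, sub_div]

theorem orthPart_sub (θ θ' : EuclideanSpace ℝ (Fin d)) :
    orthPart θs (θ - θ') = orthPart θs θ - orthPart θs θ' := by
  simp only [orthPart, signalPart_sub, sub_div, sub_smul]
  abel

theorem signalPart_combination (hs : θs ≠ 0) (A B : ℝ) (θ : EuclideanSpace ℝ (Fin d)) :
    signalPart θs (A • θs + B • θ) = A * ‖θs‖ + B * signalPart θs θ := by
  have hη : ‖θs‖ ≠ 0 := norm_ne_zero_iff.2 hs
  simp only [signalPart, inner_add_left, real_inner_smul_left, real_inner_self_eq_norm_sq]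
  field_simp

theorem orthPart_combination (hs : θs ≠ 0) (A B : ℝ) (θ : EuclideanSpace ℝ (Fin d)) :
    orthPart θs (A • θs + B • θ) = B • orthPart θs θ := by
  have hη : ‖θs‖ ≠ 0 := norm_ne_zero_iff.2 hs
  rw [orthPart, signalPart_combination hs, orthPart, add_div, mul_div_cancel_right₀ _ hη,
    mul_div_assoc]
  module

theorem norm_sub_le_parts (hs : θs ≠ 0) (θ : EuclideanSpace ℝ (Fin d)) :
    ‖θ - θs‖ ≤ |signalPart θs θ - ‖θs‖| + ‖orthPart θs θ‖ := by
  have hη : ‖θs‖ ≠ 0 := norm_ne_zero_iff.2 hs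
  have e : θ - θs = ((signalPart θs θ - ‖θs‖) / ‖θs‖) • θs + orthPart θs θ := by
    rw [orthPart, sub_div, div_self hη]
    module
  rw [e]
  refine (norm_add_le _ _).trans (le_of_eq ?_)
  rw [norm_smul, Real.norm_eq_abs, abs_div, abs_norm, div_mul_cancel₀ _ hη]

theorem parts_sub_le (hs : θs ≠ 0) (θ : EuclideanSpace ℝ (Fin d)) :
    |signalPart θs θ - ‖θs‖| ≤ ‖θ - θs‖ ∧ ‖orthPart θs θ‖ ≤ ‖θ - θs‖ := by
  have hη : ‖θs‖ ≠ 0 := norm_ne_zero_iff.2 hs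
  have h1 : signalPart θs θs = ‖θs‖ := by
    rw [signalPart, real_inner_self_eq_norm_sq, sq, mul_div_cancel_right₀ _ hη]
  have h2 : orthPart θs θs = 0 := by rw [orthPart, h1, div_self hη, one_smul, sub_self]
  have h3 := abs_signalPart_le hs (θ - θs)
  have h4 := norm_orthPart_le hs (θ - θs)
  rw [signalPart_sub, h1] at h3
  rw [orthPart_sub, h2, sub_zero] at h4
  exact ⟨h3, h4⟩

/-- `signalMap` has its coefficients at standard deviation `α` rather than `‖θ‖`; each exchange
costs `4 (‖θ‖² - α²) = 4 b²`. -/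
theorem perturbedStep_of_near_popMean {ρ k ω : ℝ} (h : |ρ| < 1) (hs : θs ≠ 0)
    (θ θ' : EuclideanSpace ℝ (Fin d))
    (hB : selfCoef ρ (inner ℝ θ θs) ‖θ‖ ≤ 1 - k * (ρ ^ 2 + ‖θ‖ ^ 2))
    (hθ' : ‖θ' - popMean θs ρ θ ρ‖ ≤ max ‖θ‖ ρ * ω) :
    PerturbedStep (signalMap ρ ‖θs‖) k ‖θs‖ ρ ω (signalPart θs θ) ‖orthPart θs θ‖ ‖θ‖
      (signalPart θs θ') ‖orthPart θs θ'‖ := by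
  have hη : ‖θs‖ ≠ 0 := norm_ne_zero_iff.2 hs
  set α := signalPart θs θ with hα
  set b := ‖orthPart θs θ‖ with hb
  have hτ : ‖θ‖ ^ 2 = α ^ 2 + b ^ 2 := norm_sq_eq_parts hs θ
  have hm : inner ℝ θ θs = ‖θs‖ * α := by rw [hα, signalPart]; field_simp
  have hpop := popMean_eq h θs θ
  refine ⟨norm_nonneg _, hτ, ?_, ⟨_, selfCoef_nonneg h (inner ℝ θ θs) ‖θ‖, hB, ?_⟩⟩
  · have h1 := (abs_signalPart_le hs _).trans hθ'
    rw [signalPart_sub, hpop, signalPart_combination hs, hm, ← hα] at h1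
    have h2 := abs_meanCoef_sub_le h (‖θs‖ * α) (‖θs‖ * α) ‖θ‖ α
    have h3 := abs_selfCoef_sub_le h (‖θs‖ * α) (‖θs‖ * α) ‖θ‖ α
    have hb2 : |‖θ‖ ^ 2 - α ^ 2| = b ^ 2 := by
      rw [hτ, add_sub_cancel_left, abs_of_nonneg (sq_nonneg b)]
    rw [sub_self, abs_zero, zero_add, hb2] at h2 h3
    rw [signalMap_eq h]
    set A := meanCoef ρ (‖θs‖ * α) ‖θ‖
    set B := selfCoef ρ (‖θs‖ * α) ‖θ‖
    set A₀ := meanCoef ρ (‖θs‖ * α) α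
    set B₀ := selfCoef ρ (‖θs‖ * α) α
    have e : signalPart θs θ' - (A₀ * ‖θs‖ + B₀ * α) =
        (A - A₀) * ‖θs‖ + (B - B₀) * α + (signalPart θs θ' - (A * ‖θs‖ + B * α)) := by ring
    rw [e]
    calc _ ≤ |A - A₀| * ‖θs‖ + |B - B₀| * |α| + |signalPart θs θ' - (A * ‖θs‖ + B * α)| := by
          refine (abs_add_le _ _).trans ?_
          gcongr
          refine (abs_add_le _ _).trans ?_
          rw [abs_mul, abs_mul, abs_norm]
      _ ≤ 4 * b ^ 2 * ‖θs‖ + 4 * b ^ 2 * |α| + max ‖θ‖ ρ * ω := by gcongr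
      _ = _ := by ring
  · have h1 := (norm_orthPart_le hs _).trans hθ'
    rw [orthPart_sub, hpop, orthPart_combination hs] at h1
    have h2 := norm_le_norm_sub_add (orthPart θs θ') (selfCoef ρ (inner ℝ θ θs) ‖θ‖ • orthPart θs θ)
    rw [norm_smul, Real.norm_eq_abs, abs_of_nonneg (selfCoef_nonneg h _ _)] at h2
    linarith

end

/-! ### The initialisations -/

theorem popMean_zero {ρ : ℝ} (h : |ρ| < 1) (θs : EuclideanSpace ℝ (Fin d)) :
    popMean θs ρ 0 ρ = ρ ^ 2 • θs := by
  rw [popMean_eq h]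
  have h1 : meanCoef ρ 0 0 = ρ ^ 2 := by
    have : response ρ 0 = ρ ^ 2 := by rw [response_eq h]; simp
    simp [meanCoef, this]
  simp [h1]

theorem sampleMean_zero {n : ℕ} {ρ : ℝ} (h : |ρ| < 1) (x : Fin n → EuclideanSpace ℝ (Fin d)) :
    sampleMean x 0 ρ = ρ • sampleAverage x := by
  simp only [sampleMean, sampleAverage, emTerm, inner_zero_left, zero_add, tanh_beta h]
  rw [← Finset.smul_sum, smul_comm]

/-- At `θ = 0` concentration compares `ρ 𝔼_n[X]` with `ρ² θs` to accuracy `ρω`; division by `ρ²`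
gives the estimate. -/
theorem norm_moment_sub_le {n : ℕ} {ρ Cθ Cω : ℝ} (hCθ : 0 ≤ Cθ) (h0 : 0 < ρ) (h : ρ < 1)
    {θs : EuclideanSpace ℝ (Fin d)} {x : Fin n → EuclideanSpace ℝ (Fin d)}
    (hx : ConcentrationEvent Cθ Cω θs ρ x) :
    ‖(1 / ρ) • sampleAverage x - θs‖ ≤ omega Cω d n / ρ := by
  have hρ : |ρ| < 1 := abs_lt.2 ⟨by linarith, h⟩
  have h1 := hx 0 (by rw [norm_zero]; positivity)
  rw [popMean_zero hρ, sampleMean_zero hρ, norm_zero, max_eq_right h0.le] at h1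
  have e : ρ • sampleAverage x - ρ ^ 2 • θs = (ρ ^ 2) • ((1 / ρ) • sampleAverage x - θs) := by
    rw [smul_sub, smul_smul]
    congr 2
    field_simp
  rw [e, norm_smul, Real.norm_eq_abs, abs_of_pos (by positivity)] at h1
  rw [le_div_iff₀ h0]
  have : ρ * (‖(1 / ρ) • sampleAverage x - θs‖ * ρ) ≤ ρ * omega Cω d n := by
    linarith
  exact le_of_mul_le_mul_left this h0

theorem omega_pos {Cω : ℝ} {n : ℕ} (h : 0 < Cω) (hd : 1 ≤ d) (hn : 2 ≤ n) : 0 < omega Cω d n := by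
  have h1 : (0 : ℝ) < d := by exact_mod_cast hd
  have h2 : (2 : ℝ) ≤ n := by exact_mod_cast hn
  have h3 : 0 < Real.log n := Real.log_pos (by linarith)
  unfold omega
  positivity

/-! ### Convergence of the empirical iteration -/

section

variable {n : ℕ} {θs θ₀ : EuclideanSpace ℝ (Fin d)} {x : Fin n → EuclideanSpace ℝ (Fin d)}
  {k R Cθ Cω ρ : ℝ}

theorem emIter_small_signal (hk0 : 0 < k) (hk : k ≤ 1) (h0 : 0 < ρ) (h1 : ρ < 1)
    (hself : ∀ m τ, 0 ≤ τ → τ ≤ R → selfCoef ρ m τ ≤ 1 - k * (ρ ^ 2 + τ ^ 2))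
    (hR : R ≤ 5 * (Real.sqrt d + Cθ)) (hR2 : 2 ≤ R) (hx : ConcentrationEvent Cθ Cω θs ρ x)
    (hω0 : 0 ≤ omega Cω d n) (hω : omega Cω d n ≤ k / 8 * ρ ^ 2) (hη : ‖θs‖ ≤ k / 40 * ρ)
    (hθ₀ : ‖θ₀ - θs‖ ≤ ρ) (t : ℕ) :
    ‖emIter x ρ θ₀ t - θs‖ ≤ Real.exp (-(k * ρ ^ 2 / 4 * t)) * ‖θ₀ - θs‖ +
      8 / k * (omega Cω d n / ρ) := by
  refine small_signal_recursion (e := fun t => ‖emIter x ρ θ₀ t - θs‖) hk0 hk h0 h1 hω0 hω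
    (fun t => norm_nonneg _) hθ₀ (fun t ht => ?_) t
  set θ := emIter x ρ θ₀ t
  have hηρ : ‖θs‖ ≤ ρ := hη.trans (by nlinarith)
  have hτ : ‖θ‖ ≤ ‖θ - θs‖ + ρ := (norm_le_norm_sub_add θ θs).trans (by linarith)
  have hτR : ‖θ‖ ≤ R := by linarith
  have h2 := hx θ (hτR.trans hR)
  have h3 := norm_popMean_sub_le h0 h1 hk0 hk θs θ hη (hself _ _ (norm_nonneg _) hτR)
  have hmax : max ‖θ‖ ρ ≤ ‖θ - θs‖ + 2 * ρ :=
    max_le (by linarith) (by linarith [norm_nonneg (θ - θs)])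
  have h4 := mul_le_mul_of_nonneg_right hmax hω0
  change ‖sampleMean x θ ρ - θs‖ ≤ _
  have h5 := norm_sub_le_norm_sub_add_norm_sub (sampleMean x θ ρ) (popMean θs ρ θ ρ) θs
  linarith

theorem emIter_large_signal {C₄ C₆ ε : ℝ} (h : LargeSignal k C₄ ε ‖θs‖ ρ (omega Cω d n))
    (hF : SignalDrift (signalMap ρ ‖θs‖) k ‖θs‖ ρ)
    (hself : ∀ m τ, 0 ≤ τ → τ ≤ R → selfCoef ρ m τ ≤ 1 - k * (ρ ^ 2 + τ ^ 2))
    (hR : R ≤ 5 * (Real.sqrt d + Cθ)) (hR2 : 2 * Cθ + 1 ≤ R) (hx : ConcentrationEvent Cθ Cω θs ρ x)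
    (hη : ‖θs‖ ≤ Cθ) (hC₆ : 0 < C₆) (hC₆k : C₆ ≤ k / 2) (hC₆e : C₆ ≤ Real.exp (-1))
    (hinit : Invariant k ‖θs‖ ρ (omega Cω d n) (signalPart θs θ₀) ‖orthPart θs θ₀‖) (t : ℕ)
    (ht : (12 / k + 2 * Cθ ^ 2) *
      (1 / ‖θs‖ ^ 2 * Real.log (1 / (C₆ * ρ * omega Cω d n))) ≤ t) :
    ‖emIter x ρ θ₀ t - θs‖ ≤ ((1 + 1 / C₄) * Cθ ^ 2 + 8 * noiseConst k C₄ / k) *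
      (omega Cω d n / ‖θs‖) := by
  have hs : θs ≠ 0 := norm_pos_iff.1 h.η_pos
  have hρ : |ρ| < 1 := abs_lt.2 ⟨by linarith [h.ρ_pos], h.ρ_lt⟩
  refine (norm_sub_le_parts hs _).trans ?_
  refine large_signal_convergence (α := fun t => signalPart θs (emIter x ρ θ₀ t))
    (b := fun t => ‖orthPart θs (emIter x ρ θ₀ t)‖) (τ := fun t => ‖emIter x ρ θ₀ t‖) h hF hη hC₆ hC₆k
    hC₆e (fun t => norm_nonneg _) hinit (fun t hi => ?_) t ht
  set θ := emIter x ρ θ₀ t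
  have hτR : ‖θ‖ ≤ R := by
    have h1 : ‖θ‖ ≤ signalPart θs θ + ‖orthPart θs θ‖ := by
      refine le_of_sq_le_sq ?_ (add_nonneg hi.α_nonneg hi.b_nonneg)
      rw [norm_sq_eq_parts hs θ]
      nlinarith [mul_nonneg hi.α_nonneg hi.b_nonneg]
    have h2 := hi.b_le_ρ h
    have h3 := hi.α_le
    have h4 := h.ρ_lt
    linarith
  exact perturbedStep_of_near_popMean hρ hs θ _ (hself _ _ (norm_nonneg _) hτR)
    (hx θ (hτR.trans hR))

theorem invariant_zero {C₄ ε ω : ℝ} (h : LargeSignal k C₄ ε ‖θs‖ ρ ω) :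
    Invariant k ‖θs‖ ρ ω (signalPart θs 0) ‖orthPart θs 0‖ := by
  have e1 : signalPart θs 0 = 0 := by simp [signalPart]
  have e2 : orthPart θs 0 = 0 := by simp [orthPart, e1]
  rw [e1, e2, norm_zero]
  exact ⟨le_rfl, by positivity, le_rfl, (div_pos h.ω_pos (mul_pos h.k_pos h.ρ_pos)).le⟩

theorem invariant_of_near {C₄ ε ω : ℝ} (h : LargeSignal k C₄ ε ‖θs‖ ρ ω) (hε : ε ≤ C₄)
    (hθ₀ : ‖θ₀ - θs‖ ≤ ω / ρ) :
    Invariant k ‖θs‖ ρ ω (signalPart θs θ₀) ‖orthPart θs θ₀‖ := by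
  have hs : θs ≠ 0 := norm_pos_iff.1 h.η_pos
  have hρ := h.ρ_pos
  have hk := h.k_pos
  obtain ⟨p1, p2⟩ := parts_sub_le hs θ₀
  have h1 : ω / ρ ≤ ‖θs‖ := by
    rw [div_le_iff₀ hρ]
    calc ω ≤ ε * ρ ^ 2 := h.ω_le
      _ ≤ C₄ * ρ ^ 2 := by gcongr
      _ = C₄ * ρ * ρ := by ring
      _ ≤ _ := by gcongr; exact h.η_large
  have h2 := abs_le.1 (p1.trans (hθ₀.trans h1))
  refine ⟨by linarith, by linarith, norm_nonneg _, p2.trans (hθ₀.trans ?_)⟩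
  have := h.ω_pos
  gcongr
  exact mul_le_of_le_one_left hρ.le h.k_le

end

/-! ### Choice of constants -/

/-- The common rate constant. -/
def rate (Cθ Cρ : ℝ) : ℝ :=
  min (min (ascentRate Cθ / 2) (Real.exp (-(Cθ ^ 2) / 2) / 2))
    (min (shrinkRate Cρ (2 * Cθ + 2)) (1 / (1 + Cθ ^ 2)))

theorem rate_pos {Cθ Cρ : ℝ} (h : Cρ < 1) : 0 < rate Cθ Cρ := by
  have h1 := ascentRate_pos Cθ
  have h2 := shrinkRate_pos h (2 * Cθ + 2)
  exact lt_min (lt_min (by positivity) (by positivity)) (lt_min h2 (by positivity))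

theorem rate_le_inv (Cθ Cρ : ℝ) : rate Cθ Cρ ≤ 1 / (1 + Cθ ^ 2) :=
  (min_le_right _ _).trans (min_le_right _ _)

theorem rate_le_one (Cθ Cρ : ℝ) : rate Cθ Cρ ≤ 1 := by
  refine (rate_le_inv Cθ Cρ).trans ?_
  rw [div_le_one (by positivity)]
  linarith [sq_nonneg Cθ]

theorem selfCoef_le_rate {Cθ Cρ ρ : ℝ} (hC : Cρ < 1) (h0 : 0 ≤ ρ) (hρ : ρ ≤ Cρ) (m τ : ℝ)
    (hτ0 : 0 ≤ τ) (hτ : τ ≤ 2 * Cθ + 2) :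
    selfCoef ρ m τ ≤ 1 - rate Cθ Cρ * (ρ ^ 2 + τ ^ 2) := by
  have h1 : rate Cθ Cρ ≤ shrinkRate Cρ (2 * Cθ + 2) := (min_le_right _ _).trans (min_le_left _ _)
  have h2 := selfCoef_le h0 hρ hC hτ0 hτ m
  have h3 : rate Cθ Cρ * (ρ ^ 2 + τ ^ 2) ≤ shrinkRate Cρ (2 * Cθ + 2) * (ρ ^ 2 + τ ^ 2) := by gcongr
  linarith

theorem signalDrift_signalMap {Cθ Cρ ρ η : ℝ} (h0 : 0 ≤ ρ) (h1 : ρ < 1) (hη0 : 0 ≤ η)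
    (hη : η ≤ Cθ) : SignalDrift (signalMap ρ η) (rate Cθ Cρ) η ρ := by
  have hρ : |ρ| < 1 := abs_lt.2 ⟨by linarith, h1⟩
  refine ⟨signalMap_mono hρ η, signalMap_self hρ η, fun α hα hαη => ?_, fun α hα => ?_⟩
  · refine le_trans ?_ (ascent_le_signalMap_sub hρ hα hαη hη)
    have : rate Cθ Cρ ≤ ascentRate Cθ / 2 := (min_le_left _ _).trans (min_le_left _ _)
    have : 0 ≤ η - α := by linarith
    gcongr
  · refine (signalMap_sub_le h0 h1 hη0 hα).trans ?_
    have h2 : rate Cθ Cρ ≤ Real.exp (-(Cθ ^ 2) / 2) / 2 := (min_le_left _ _).trans (min_le_right _ _)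
    have h3 := exp_neg_half_sq_le hη0 hη
    have h4 : rate Cθ Cρ * η ^ 2 ≤ Real.exp (-(Cθ ^ 2) / 2) / 2 * η ^ 2 := by gcongr
    have : 0 ≤ α - η := by linarith
    gcongr
    linarith

/-- The admissible ratio `ω / ρ²`. -/
def noiseRatio (k : ℝ) : ℝ := min (k / 8) (k * (k / 40) ^ 2 / (4 * noiseConst k (k / 40)))

theorem noiseConst_ge_two {k C₄ : ℝ} (hk : 0 < k) (hC : 0 < C₄) : 2 ≤ noiseConst k C₄ := by
  have h1 : 0 < 12 / k ^ 2 := by positivity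
  have h2 : 0 < 2 / C₄ := by positivity
  unfold noiseConst; linarith

theorem noiseRatio_pos {k : ℝ} (hk : 0 < k) : 0 < noiseRatio k := by
  have := noiseConst_ge_two hk (by positivity : 0 < k / 40)
  have : 0 < noiseConst k (k / 40) := by linarith
  exact lt_min (by positivity) (by positivity)

theorem noiseConst_mul_noiseRatio_le {k : ℝ} (hk : 0 < k) :
    noiseConst k (k / 40) * noiseRatio k ≤ k * (k / 40) ^ 2 / 4 := by
  have h1 := noiseConst_ge_two hk (by positivity : 0 < k / 40)
  have h2 : 0 < noiseConst k (k / 40) := by linarith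
  calc noiseConst k (k / 40) * noiseRatio k
      ≤ noiseConst k (k / 40) * (k * (k / 40) ^ 2 / (4 * noiseConst k (k / 40))) := by
        gcongr; exact min_le_right _ _
    _ = _ := by field_simp

theorem noiseRatio_le {k : ℝ} (hk : 0 < k) (hk1 : k ≤ 1) : noiseRatio k ≤ k / 40 := by
  have h1 := noiseConst_ge_two hk (by positivity : 0 < k / 40)
  have h2 := noiseConst_mul_noiseRatio_le hk
  have h3 := noiseRatio_pos hk
  have h4 : k * (k / 40) ^ 2 / 4 ≤ k / 40 := by
    have : k * (k / 40) ≤ 1 := by nlinarith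
    calc k * (k / 40) ^ 2 / 4 = k * (k / 40) * (k / 40) / 4 := by ring
      _ ≤ 1 * (k / 40) / 4 := by gcongr
      _ ≤ _ := by linarith
  nlinarith

/-- The orthogonal component is already controlled within the signal time, so the extra time enters
only through its sign and `D₃ = D₄ = 1` suffices. -/
theorem orthogonalTime_nonneg {η ρ ω : ℝ} (hω : 0 < ω) (h : ω ≤ ρ) :
    0 ≤ orthogonalTime 1 1 η ρ ω := by
  unfold orthogonalTime
  split_ifs with h1
  · exact zero_le_one
  · push Not at h1
    have : 0 ≤ Real.log (η / (1 * ω)) := by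
      apply Real.log_nonneg
      rw [one_mul, one_le_div hω]; linarith
    positivity

end EMMixture

end

/-! ### Assembly of the two regimes. -/

open EMMixture in
theorem mainTheorem1 (Cθ Cρ : ℝ) (hCθ : 0 < Cθ) (hCρ : 0 < Cρ) (hCρ1 : Cρ < 1) :
    ∃ (n₀ : ℕ) (C₁ C₂ C₃ C₄ C₅ C₆ D₃ D₄ : ℝ),
      0 < C₁ ∧ 0 < C₂ ∧ 0 < C₃ ∧ 0 < C₄ ∧ 0 < C₅ ∧ 0 < C₆ ∧ 0 < D₃ ∧ 0 < D₄ ∧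
      ∀ Cω : ℝ, 0 < Cω → ∀ d n : ℕ, 1 ≤ d → n₀ ≤ n →
      ∀ (θs : EuclideanSpace ℝ (Fin d)) (ρs : ℝ), ‖θs‖ ≤ Cθ → |ρs| ≤ Cρ →
      C₁ * Real.sqrt (EMMixture.omega Cω d n) < ρs →
      ∀ x : Fin n → EuclideanSpace ℝ (Fin d),
      EMMixture.ConcentrationEvent Cθ Cω θs ρs x →
      (∀ t : ℕ,
        EMMixture.signalTimeZero C₃ C₄ C₅ C₆ ‖θs‖ ρs (EMMixture.omega Cω d n) +
            EMMixture.orthogonalTime D₃ D₄ ‖θs‖ ρs (EMMixture.omega Cω d n) ≤ (t : ℝ) →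
        ‖EMMixture.emIter x ρs 0 t - θs‖ ≤
          C₂ * (EMMixture.omega Cω d n / max ρs ‖θs‖)) ∧
      (∀ t : ℕ,
        EMMixture.signalTimeMoment C₃ C₄ C₆ ‖θs‖ ρs (EMMixture.omega Cω d n) +
            EMMixture.orthogonalTime D₃ D₄ ‖θs‖ ρs (EMMixture.omega Cω d n) ≤ (t : ℝ) →
        ‖EMMixture.emIter x ρs ((1 / ρs) • EMMixture.sampleAverage x) t - θs‖ ≤
          C₂ * (EMMixture.omega Cω d n / max ρs ‖θs‖)) := by
  set k := rate Cθ Cρ with hkdef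
  have hk : 0 < k := rate_pos hCρ1
  have hk1 : k ≤ 1 := rate_le_one Cθ Cρ
  set N := noiseConst k (k / 40) with hN
  have hN0 : 0 < N := by
    have := noiseConst_ge_two hk (by positivity : 0 < k / 40)
    linarith
  set ε := noiseRatio k with hε
  have hε0 : 0 < ε := noiseRatio_pos hk
  have hεk8 : ε ≤ k / 8 := min_le_left _ _
  have hε40 : ε ≤ k / 40 := noiseRatio_le hk hk1
  set K := (1 + 1 / (k / 40)) * Cθ ^ 2 + 8 * N / k with hK
  have hK0 : 0 < K := by positivity
  have hC₆ : 0 < min (k / 2) (Real.exp (-1)) := lt_min (by positivity) (Real.exp_pos _)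
  -- `C₁ = 1/√ε` turns the lower bound on `ρ` into `ω ≤ ε ρ²`. In `C₂`, `1 + 8/k` serves small
  -- signals, and `K/(k/40)` serves large ones, where `max ρ η ≤ η/(k/40)`. The sample size `2`
  -- makes `log n` positive.
  refine ⟨2, 1 / Real.sqrt ε, 1 + 8 / k + K / (k / 40), 12 / k + 2 * Cθ ^ 2, k / 40, 1,
    min (k / 2) (Real.exp (-1)), 1, 1, by positivity, by positivity, by positivity, by positivity,
    one_pos, hC₆, one_pos, one_pos, ?_⟩
  intro Cω hCω d n hd hn θs ρ hη hρabs hρω x hx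
  set ω := omega Cω d n with hωdef
  have hω : 0 < ω := omega_pos hCω hd hn
  have hρ0 : 0 < ρ := lt_trans (by positivity) hρω
  have hρC : ρ ≤ Cρ := (le_abs_self ρ).trans hρabs
  have hρ1 : ρ < 1 := hρC.trans_lt hCρ1
  have hωρ : ω ≤ ε * ρ ^ 2 := by
    rw [one_div_mul_eq_div, div_lt_iff₀ (Real.sqrt_pos.2 hε0)] at hρω
    have h1 : Real.sqrt ω ^ 2 ≤ (ρ * Real.sqrt ε) ^ 2 := by gcongr
    rw [mul_pow, Real.sq_sqrt hω.le, Real.sq_sqrt hε0.le] at h1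
    linarith
  have hωρ' : ω / ρ ≤ k / 40 * ρ := by
    rw [div_le_iff₀ hρ0]
    calc ω ≤ ε * ρ ^ 2 := hωρ
      _ ≤ k / 40 * ρ ^ 2 := by gcongr
      _ = _ := by ring
  have hk40ρ : k / 40 * ρ ≤ ρ := mul_le_of_le_one_left hρ0.le (by linarith)
  have hωleρ : ω ≤ ρ := by
    have h1 := hωρ'.trans hk40ρ
    rw [div_le_iff₀ hρ0] at h1
    nlinarith
  have hd1 : (1 : ℝ) ≤ Real.sqrt d := by
    rw [Real.one_le_sqrt]; exact_mod_cast hd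
  -- As `d ≥ 1`, the concentration ball contains the radius `2 Cθ + 2` within which the iterates
  -- stay.
  have hR : 2 * Cθ + 2 ≤ 5 * (Real.sqrt d + Cθ) := by linarith
  have hself := selfCoef_le_rate (Cθ := Cθ) hCρ1 hρ0.le hρC
  have hT := orthogonalTime_nonneg (η := ‖θs‖) hω hωleρ
  have hmoment := norm_moment_sub_le hCθ.le hρ0 hρ1 hx
  rcases le_or_gt ‖θs‖ (k / 40 * ρ) with hsmall | hlarge
  · have hmax : max ρ ‖θs‖ = ρ := max_eq_left (hsmall.trans hk40ρ)
    have hωk : ω ≤ k / 8 * ρ ^ 2 := hωρ.trans (by gcongr)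
    have conv := fun (θ₀ : EuclideanSpace ℝ (Fin d)) (hθ₀ : ‖θ₀ - θs‖ ≤ ρ) (t : ℕ) =>
      emIter_small_signal hk hk1 hρ0 hρ1 hself hR (by linarith) hx hω.le hωk hsmall hθ₀ t
    have fin : ∀ e : ℝ, e ≤ ω / ρ + 8 / k * (ω / ρ) →
        e ≤ (1 + 8 / k + K / (k / 40)) * (ω / max ρ ‖θs‖) := by
      intro e he
      rw [hmax]
      have : 0 ≤ K / (k / 40) * (ω / ρ) := by positivity
      linarith
    have expLe : ∀ t : ℕ, Real.exp (-(k * ρ ^ 2 / 4 * t)) ≤ 1 := by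
      intro t
      rw [Real.exp_le_one_iff]
      have : 0 ≤ k * ρ ^ 2 / 4 * t := by positivity
      linarith
    -- A start within `ω/ρ` of the truth never leaves the target accuracy.
    have near : ∀ (θ₀ : EuclideanSpace ℝ (Fin d)), ‖θ₀ - θs‖ ≤ ω / ρ → ∀ t : ℕ,
        ‖emIter x ρ θ₀ t - θs‖ ≤ (1 + 8 / k + K / (k / 40)) * (ω / max ρ ‖θs‖) := by
      intro θ₀ hθ₀ t
      apply fin
      refine (conv θ₀ (hθ₀.trans (hωρ'.trans hk40ρ)) t).trans ?_
      have := mul_le_mul (expLe t) hθ₀ (norm_nonneg _) zero_le_one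
      linarith
    refine ⟨fun t ht => ?_, fun t _ => near _ hmoment t⟩
    by_cases h1 : ‖θs‖ ≤ ω / ρ
    · exact near 0 (by rwa [zero_sub, norm_neg]) t
    · have h2 : ‖(0 : EuclideanSpace ℝ (Fin d)) - θs‖ ≤ ρ := by
        rw [zero_sub, norm_neg]; exact hsmall.trans hk40ρ
      apply fin
      refine (conv 0 h2 t).trans ?_
      have h3 : (12 / k + 2 * Cθ ^ 2) * (1 / ρ ^ 2 * Real.log (ρ / ω)) ≤ t := by
        rw [signalTimeZero, if_neg h1, if_pos hsmall, one_mul] at ht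
        linarith
      have hlog : 0 ≤ Real.log (ρ / ω) := Real.log_nonneg ((one_le_div hω).2 hωleρ)
      have h4 : Real.log (ρ / ω) ≤ k * ρ ^ 2 / 4 * t := by
        have h5 : 4 / k * (1 / ρ ^ 2 * Real.log (ρ / ω)) ≤
            (12 / k + 2 * Cθ ^ 2) * (1 / ρ ^ 2 * Real.log (ρ / ω)) := by
          gcongr
          have : 4 / k ≤ 12 / k := by gcongr; norm_num
          linarith [sq_nonneg Cθ]
        calc Real.log (ρ / ω) = k * ρ ^ 2 / 4 * (4 / k * (1 / ρ ^ 2 * Real.log (ρ / ω))) := by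
              field_simp
          _ ≤ k * ρ ^ 2 / 4 * t := by
              gcongr; exact h5.trans h3
      have h6 : Real.exp (-(k * ρ ^ 2 / 4 * t)) ≤ ω / ρ := by
        calc _ ≤ Real.exp (-Real.log (ρ / ω)) := by rw [Real.exp_le_exp]; linarith
          _ = ω / ρ := by rw [Real.exp_neg, Real.exp_log (by positivity), inv_div]
      have h7 := mul_le_mul h6 (h2.trans hρ1.le) (norm_nonneg _) (by positivity)
      linarith
  · have hrate : k * ‖θs‖ ^ 2 ≤ 1 := by
      have h1 := rate_le_inv Cθ Cρ
      rw [← hkdef, le_div_iff₀ (by positivity)] at h1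
      have h2 : k * ‖θs‖ ^ 2 ≤ k * Cθ ^ 2 := by gcongr
      linarith
    have hL : LargeSignal k (k / 40) ε ‖θs‖ ρ ω :=
      ⟨hk, hk1, by positivity, by linarith, hε0, by linarith, noiseConst_mul_noiseRatio_le hk, hρ0,
        hρ1, hω, hωρ, hlarge.le, hrate⟩
    have hη0 := hL.η_pos
    have hF := signalDrift_signalMap (Cρ := Cρ) hρ0.le hρ1 (norm_nonneg θs) hη
    have fin : ∀ e : ℝ, e ≤ K * (ω / ‖θs‖) →
        e ≤ (1 + 8 / k + K / (k / 40)) * (ω / max ρ ‖θs‖) := by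
      intro e he
      have h1 : max ρ ‖θs‖ ≤ ‖θs‖ / (k / 40) :=
        max_le hL.ρ_le (le_div_self (norm_nonneg _) (by positivity) (by linarith))
      have h2 : 0 < max ρ ‖θs‖ := lt_max_of_lt_left hρ0
      calc e ≤ K * (ω / ‖θs‖) := he
        _ = K / (k / 40) * (ω / (‖θs‖ / (k / 40))) := by field_simp
        _ ≤ K / (k / 40) * (ω / max ρ ‖θs‖) := by gcongr
        _ ≤ _ := by
          gcongr
          have : 0 < 8 / k := by positivity
          linarith
    have conv := fun (θ₀ : EuclideanSpace ℝ (Fin d)) hinit (t : ℕ) ht =>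
      fin _ (emIter_large_signal (θ₀ := θ₀) hL hF hself hR (by linarith) hx hη hC₆
        (min_le_left _ _) (min_le_right _ _) hinit t ht)
    refine ⟨fun t ht => conv 0 (invariant_zero hL) t ?_,
      fun t ht => conv _ (invariant_of_near hL hε40 hmoment) t ?_⟩
    -- The first case of the signal time cannot occur, because `ω/ρ ≤ C₄ ρ < η`; the term `1/(ρη)`
    -- is nonnegative slack.
    · rw [signalTimeZero, if_neg (not_le.2 (hωρ'.trans_lt hlarge)), if_neg (not_le.2 hlarge),
        mul_add] at ht
      have : 0 ≤ (12 / k + 2 * Cθ ^ 2) * (1 / (ρ * ‖θs‖)) := by positivity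
      linarith
    · rw [signalTimeMoment, if_neg (not_le.2 hlarge)] at ht
      linarith
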